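/- Let $\mathcal X,\mathcal Y$ be finite-dimensional real Euclidean spaces, $\mathcal A:\mathcal X\to\mathcal Y$ a linear map with adjoint $\mathcal A^*$, $c\in\mathcal X$, and let $h:\mathcal Y\to\mathbb R$ and $p:\mathcal X\to(-\infty,+\infty]$ be closed proper convex functions with Fenchel conjugates $h^*$ and $p^*$. Consider the problem $$(D)\qquad \min\{h^*(y)+p^*(z)\mid \mathcal A^*y+z=c\},$$ its Lagrangian $l(y,z,x)=h^*(y)+p^*(z)-\langle x,\mathcal A^*y+z-c\rangle$ on $\mathcal Y\times\mathcal X\times\mathcal X$, and the operator $$\mathcal T_l(y,z,x)=\{(y',z',x')\mid (y',z',-x')\in\partial l(y,z,x)\},$$ where $\partial l$ is the subdifferential of the convex-concave function $l$ (convex subgradients in $(y,z)$, concave subgradients in $x$). Assume the following. (i) $h^*$ is essentially smooth: $\operatorname{int}(\operatorname{dom}h^*)\neq\emptyset$, $h^*$ is differentiable on $\operatorname{int}(\operatorname{dom}h^*)$, and $\|\nabla h^*(y^k)\|\to+\infty$ whenever $\{y^k\}\subset\operatorname{int}(\operatorname{dom}h^*)$ converges to a boundary point of $\operatorname{int}(\operatorname{dom}h^*)$.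 Moreover, $\nabla h^*$ is locally Lipschitz continuous and directionally differentiable on $\operatorname{int}(\operatorname{dom}h^*)$. (ii) There is a nonempty polyhedral convex set $P\subseteq\mathcal X$ such that $p^*$ is either the indicator function $\delta_P$ or the support function $\delta_P^*$ of $P$. (iii) $(\bar x,\bar y,\bar z)\in\mathcal X\times\mathcal Y\times\mathcal X$ solves the KKT system of $(D)$: $$0\in\partial h^*(y)-\mathcal Ax,\qquad 0\in -x+\partial p^*(z),\qquad 0=\mathcal A^*y+z-c.$$ (iv) The second order sufficient condition for $(D)$ holds at $(\bar y,\bar z)$: $\langle d_1,(\nabla h^*)'(\bar y;d_1)\rangle>0$ for every nonzero $(d_1,d_2)$ in the critical cone $$\mathcal C(\bar y,\bar z)=\{(d_1,d_2)\in\mathcal Y\times\mathcal X\mid \mathcal A^*d_1+d_2=0,\ \langle\nabla h^*(\bar y),d_1\rangle+(p^*)'(\bar z;d_2)=0,\ d_2\in\mathcal T_{\operatorname{dom}(p^*)}(\bar z)\},$$ where a prime denotes the one-sided directional derivative and $\mathcal T_{\operatorname{dom}(p^*)}(\bar z)$ is the tangent cone of $\operatorname{dom}(p^*)$ at $\bar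 z$. Then $\mathcal T_l$ is metrically subregular at $(\bar y,\bar z,\bar x)$ for the origin. That is, $0\in\mathcal T_l(\bar y,\bar z,\bar x)$, and there exist $\kappa\ge 0$ and neighborhoods $U$ of $(\bar y,\bar z,\bar x)$ and $V$ of $0$ such that $$\operatorname{dist}\bigl(u,\mathcal T_l^{-1}(0)\bigr)\le\kappa\,\operatorname{dist}\bigl(0,\mathcal T_l(u)\cap V\bigr)\qquad\text{for all }u\in U,$$ where the distance to the empty set is $+\infty$. -/

import Mathlib

open Set Filter Topology
open scoped NNReal ENNReal RealInnerProductSpace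

namespace ConvexComposite

noncomputable section

/-! ### Extended-real-valued convex functions on a Euclidean space -/

section ConvexFunctions

variable {E : Type*} [NormedAddCommGroup E]

/-- The effective domain of an extended-real-valued function. -/
def effDom (f : E → EReal) : Set E := {x | f x < ⊤}

/-- A proper function: it never takes the value `-∞`, and it is finite somewhere. -/
def IsProper (f : E → EReal) : Prop := (∀ x, f x ≠ ⊥) ∧ (effDom f).Nonempty

variable [InnerProductSpace ℝ E]

/-- Convexity of an extended-real-valued function: its epigraph is convex. -/
def IsConvexFun (f : E → EReal) : Prop := Convex ℝ {q : E × ℝ | f q.1 ≤ (q.2 : EReal)}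

/-- A closed proper convex function (for proper functions, closed means lower semicontinuous). -/
structure IsClosedProperConvex (f : E → EReal) : Prop where
  proper : IsProper f
  convex : IsConvexFun f
  lsc : LowerSemicontinuous f

/-- The Fenchel conjugate `f^*(z) = sup_x (⟨x, z⟩ - f x)`. -/
def fenchelConj (f : E → EReal) (z : E) : EReal := ⨆ x : E, ((⟪x, z⟫ : ℝ) : EReal) - f x

/-- The subdifferential of a convex function at `x`. -/
def subdiff (f : E → EReal) (x : E) : Set E :=
  {v | ∀ u : E, f x + ((⟪v, u - x⟫ : ℝ) : EReal) ≤ f u}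

open Classical in
/-- The indicator function `δ_P` of a set: `0` on `P` and `+∞` elsewhere. -/
def indicatorFun (P : Set E) (z : E) : EReal := if z ∈ P then 0 else ⊤

/-- The support function `δ_P^*` of a set: `z ↦ sup_{x ∈ P} ⟨x, z⟩`. -/
def supportFun (P : Set E) (z : E) : EReal := ⨆ x ∈ P, ((⟪x, z⟫ : ℝ) : EReal)

/-- A polyhedral convex set: an intersection of finitely many closed half-spaces. -/
def IsPolyhedralSet (P : Set E) : Prop :=
  ∃ S : Finset (E × ℝ), P = {x | ∀ s ∈ S, ⟪s.1, x⟫ ≤ s.2}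

/-- The one-sided directional derivative of an extended-real-valued function:
`f'(x; d) = a`, where `f'(x; d) = lim_{t ↓ 0} (f (x + t d) - f x) / t`, as a limit in `[-∞, ∞]`. -/
def HasDirDerivE (f : E → EReal) (x d : E) (a : EReal) : Prop :=
  Tendsto (fun t : ℝ => (f (x + t • d) - f x) / (t : EReal)) (𝓝[>] 0) (𝓝 a)

/-- The one-sided directional derivative of a vector-valued map: `G'(x; d) = v`, where
`G'(x; d) = lim_{t ↓ 0} (G (x + t d) - G x) / t`. -/
def HasDirDeriv (G : E → E) (x d v : E) : Prop :=
  Tendsto (fun t : ℝ => t⁻¹ • (G (x + t • d) - G x)) (𝓝[>] 0) (𝓝 v)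

variable [FiniteDimensional ℝ E]

/-- The gradient `∇ f (x)`, used at interior points of the domain where `f` is differentiable. -/
def grad (f : E → EReal) (x : E) : E :=
  haveI : CompleteSpace E := FiniteDimensional.complete ℝ E
  gradient (fun u => (f u).toReal) x

/-- Essential smoothness of a proper convex function. -/
structure EssentiallySmooth (f : E → EReal) : Prop where
  proper : IsProper f
  convex : IsConvexFun f
  nonempty_interior : (interior (effDom f)).Nonempty
  differentiableAt : ∀ x ∈ interior (effDom f), DifferentiableAt ℝ (fun u => (f u).toReal) x
  tendsto_norm_grad : ∀ (s : ℕ → E) (x : E), (∀ k, s k ∈ interior (effDom f)) →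
    x ∈ frontier (interior (effDom f)) → Tendsto s atTop (𝓝 x) →
    Tendsto (fun k => ‖grad f (s k)‖) atTop atTop

end ConvexFunctions

/-! ### Metric subregularity -/

/-- `F` is metrically subregular at `x` for `y`: `y ∈ F x`, and for some modulus `κ ≥ 0` and
neighbourhoods `U` of `x` and `V` of `y`, `dist(u, F⁻¹(y)) ≤ κ dist(y, F(u) ∩ V)` for all `u ∈ U`.
Distances are extended, so that the distance to the empty set is `+∞`. -/
def MetricSubregularAt {E F : Type*} [PseudoEMetricSpace E] [PseudoEMetricSpace F]
    (T : E → Set F) (x : E) (y : F) : Prop :=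
  y ∈ T x ∧ ∃ κ : ℝ≥0, ∃ U ∈ 𝓝 x, ∃ V ∈ 𝓝 y, ∀ u ∈ U,
    Metric.infEDist u {u' | y ∈ T u'} ≤ (κ : ℝ≥0∞) * Metric.infEDist y (T u ∩ V)

/-! ### The dual problem `min {h^*(y) + p^*(z) | A^* y + z = c}`

Below `hs` and `ps` are the functions `h^*` and `p^*` in the objective of this problem. -/

section DualProblem

variable {X Y : Type*}
  [NormedAddCommGroup X] [InnerProductSpace ℝ X] [FiniteDimensional ℝ X]
  [NormedAddCommGroup Y] [InnerProductSpace ℝ Y] [FiniteDimensional ℝ Y]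

/-- The Lagrangian `l(y, z, x) = h^*(y) + p^*(z) - ⟨x, A^* y + z - c⟩`. -/
def lagrangian (hs : Y → EReal) (ps : X → EReal) (A : X →ₗ[ℝ] Y) (c : X)
    (y : Y) (z x : X) : EReal :=
  hs y + ps z - ((⟪x, LinearMap.adjoint A y + z - c⟫ : ℝ) : EReal)

/-- The subdifferential of a function `l(y, z, x)` that is convex in `(y, z)` and concave in `x`:
the triples `(u, v, w)` such that `(u, v)` is a subgradient of the convex function `l(·, ·, x)` at
`(y, z)`, and `w` is a subgradient of the concave function `l(y, z, ·)` at `x`. -/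
def saddleSubdiff (l : Y → X → X → EReal) (q : Y × X × X) : Set (Y × X × X) :=
  {g | (∀ (y : Y) (z : X),
          l q.1 q.2.1 q.2.2 + ((⟪g.1, y - q.1⟫ + ⟪g.2.1, z - q.2.1⟫ : ℝ) : EReal)
            ≤ l y z q.2.2) ∧
       ∀ x : X, l q.1 q.2.1 x ≤ l q.1 q.2.1 q.2.2 + ((⟪g.2.2, x - q.2.2⟫ : ℝ) : EReal)}

/-- The operator `T_l(y, z, x) = {(y', z', x') | (y', z', -x') ∈ ∂l(y, z, x)}`. -/
def opTl (hs : Y → EReal) (ps : X → EReal) (A : X →ₗ[ℝ] Y) (c : X) (q : Y × X × X) :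
    Set (Y × X × X) :=
  {w | (w.1, w.2.1, -w.2.2) ∈ saddleSubdiff (lagrangian hs ps A c) q}

/-- The KKT system `0 ∈ ∂h^*(y) - A x`, `0 ∈ -x + ∂p^*(z)`, `0 = A^* y + z - c`. -/
def IsKKT (hs : Y → EReal) (ps : X → EReal) (A : X →ₗ[ℝ] Y) (c : X)
    (x : X) (y : Y) (z : X) : Prop :=
  A x ∈ subdiff hs y ∧ x ∈ subdiff ps z ∧ LinearMap.adjoint A y + z - c = 0

/-- The critical cone at `(y, z)`: all `(d₁, d₂)` with `A^* d₁ + d₂ = 0`,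
`⟨∇h^*(y), d₁⟩ + (p^*)'(z; d₂) = 0` and `d₂` in the tangent cone of `dom p^*` at `z`. -/
def criticalCone (hs : Y → EReal) (ps : X → EReal) (A : X →ₗ[ℝ] Y) (y : Y) (z : X) :
    Set (Y × X) :=
  {d | LinearMap.adjoint A d.1 + d.2 = 0 ∧
       (∃ r : ℝ, HasDirDerivE ps z d.2 (r : EReal) ∧ ⟪grad hs y, d.1⟫ + r = 0) ∧
       d.2 ∈ posTangentConeAt (effDom ps) z}

/-- The second order sufficient condition at `(y, z)`: `⟨d₁, (∇h^*)'(y; d₁)⟩ > 0` for all nonzero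
`(d₁, d₂)` in the critical cone. -/
def SecondOrderSufficient (hs : Y → EReal) (ps : X → EReal) (A : X →ₗ[ℝ] Y)
    (y : Y) (z : X) : Prop :=
  ∀ d ∈ criticalCone hs ps A y z, d ≠ 0 →
    ∃ v : Y, HasDirDeriv (grad hs) y d.1 v ∧ 0 < ⟪d.1, v⟫

/-- The blanket assumption on `h^*` and `p^*`. -/
structure BlanketAssumption (hs : Y → EReal) (ps : X → EReal) : Prop where
  essentiallySmooth : EssentiallySmooth hs
  locallyLipschitz_grad : LocallyLipschitzOn (interior (effDom hs)) (grad hs)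
  dirDiff_grad : ∀ y ∈ interior (effDom hs), ∀ d : Y, ∃ v : Y, HasDirDeriv (grad hs) y d v
  polyhedral : ∃ P : Set X, P.Nonempty ∧ IsPolyhedralSet P ∧
    (ps = indicatorFun P ∨ ps = supportFun P)

end DualProblem

end

end ConvexComposite

open ConvexComposite

/-!
At a KKT point `(yb, zb, xb)` the operator `T_l` is subregular because of two local error bounds
for a point `q = (y, z, x)` and a residual `w ∈ T_l(q)`, that is, `A x + w₁ ∈ ∂h^*(y)`, `x + w₂ ∈
∂p^*(z)` and `w₃ = A^* y + z - c` (`mem_opTl_iff`). By essential smoothness `∂h^*` is nonempty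
only in the interior of the domain, where it reduces to the gradient
(`mem_interior_of_mem_subdiff`, `eq_grad_of_mem_subdiff`).

*Multipliers* (`exists_multiplier_bound`). The points `(yb, zb, x')` with `A x' = A xb` and `x' ∈
∂p^*(zb)` are zeros of `T_l`. The set `∂p^*(zb)` is a polyhedron or a finitely generated cone, and
it contains `∂p^*(z)` for `z` near `zb`. Hoffman's lemma (`exists_hoffman_bound`) then bounds the
distance of `x` to these multipliers by `‖∇h^*(y) - ∇h^*(yb)‖ + ‖w‖`, hence by `‖y - yb‖ + ‖w‖`.

*Primal variables* (`exists_primal_bound`). If `‖(y - yb, z - zb)‖` were not bounded by a multiple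
of `‖w‖`, then along some sequence the normalized differences would converge to a unit vector
`(d₁, d₂)` while the residuals are of smaller order. The graph of `∂p^*` is a finite union of
products of a face of a polyhedron and a finitely generated cone, and tangent directions of such
sets are feasible (`tangentFeasible_polyFace`, `tangentFeasible_finCone`). Hence `xb ∈ ∂p^*(zb + s
d₂)` for small `s > 0`, so that `p^*` is affine along `d₂` with slope `⟨xb, d₂⟩` and `(d₁, d₂)` is
critical. On the other hand, monotonicity of the subdifferentials and the multiplier bound show
that `⟨∇h^*(y) - ∇h^*(yb), y - yb⟩` is of smaller order than `‖(y - yb, z - zb)‖ ^ 2`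
(`inner_grad_sub_le`). In the limit `⟨d₁, (∇h^*)'(yb; d₁)⟩ ≤ 0`, against the second order
sufficient condition.

The polyhedral facts rest on Carathéodory's theorem for cones
(`exists_linearIndepOn_of_mem_finCone`): linearly independent generators have coefficients bounded
by the norm of the combination, and they span closed cones. This gives Farkas' lemma and Hoffman's
lemma.
-/

namespace ConvexComposite

/-! ### Finitely generated convex cones -/

section FinCone

variable {ι E : Type*} [NormedAddCommGroup E] [InnerProductSpace ℝ E]

/-- The convex cone generated by the vectors `a i`, `i ∈ I`. The coefficients outside `I` are
required to be nonnegative too, which is no restriction as they do not enter the sum. -/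
def finCone (a : ι → E) (I : Finset ι) : Set E :=
  {v | ∃ w : ι → ℝ, (∀ i, 0 ≤ w i) ∧ ∑ i ∈ I, w i • a i = v}

lemma finCone_mono (a : ι → E) {I J : Finset ι} (h : J ⊆ I) : finCone a J ⊆ finCone a I := by
  classical
  rintro v ⟨w, hw, rfl⟩
  refine ⟨fun i => if i ∈ J then w i else 0, fun i => ?_, ?_⟩
  · dsimp only
    split_ifs <;> simp [hw]
  · rw [← Finset.sum_subset h]
    · exact Finset.sum_congr rfl fun i hi => by simp [hi]
    · intro i _ hi
      simp [hi]

/-- Carathéodory's theorem for cones: every element of a finitely generated cone is a nonnegative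
combination of linearly independent generators. -/
lemma exists_linearIndepOn_of_mem_finCone (a : ι → E) (I : Finset ι) {v : E}
    (hv : v ∈ finCone a I) :
    ∃ J ⊆ I, LinearIndepOn ℝ a (J : Set ι) ∧ v ∈ finCone a J := by
  classical
  induction I using Finset.strongInduction with
  | H I ih =>
    by_cases hI : LinearIndepOn ℝ a (I : Set ι)
    · exact ⟨I, subset_rfl, hI, hv⟩
    obtain ⟨g, hg, i₁, hi₁, hgpos⟩ : ∃ g : ι → ℝ, ∑ i ∈ I, g i • a i = 0 ∧ ∃ i ∈ I, 0 < g i := by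
      rw [linearIndepOn_finset_iff] at hI
      push Not at hI
      obtain ⟨g, hg, i, hi, hne⟩ := hI
      rcases lt_or_gt_of_ne hne with h | h
      · exact ⟨fun i => -g i, by simp [hg], i, hi, by simpa using h⟩
      · exact ⟨g, hg, i, hi, h⟩
    obtain ⟨w, hw, rfl⟩ := hv
    -- move along the linear relation until the first coefficient vanishes
    obtain ⟨i₀, hi₀, hmin⟩ := (I.filter (0 < g ·)).exists_min_image (fun i => w i / g i)
      ⟨i₁, by simp [hi₁, hgpos]⟩
    rw [Finset.mem_filter] at hi₀
    obtain ⟨hi₀, hg₀⟩ := hi₀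
    have hr : 0 ≤ w i₀ / g i₀ := div_nonneg (hw _) hg₀.le
    have key : ∑ i ∈ I.erase i₀, (w i - w i₀ / g i₀ * g i) • a i = ∑ i ∈ I, w i • a i := by
      rw [Finset.sum_erase I (by rw [div_mul_cancel₀ _ hg₀.ne']; simp)]
      simp only [sub_smul, mul_smul, Finset.sum_sub_distrib, ← Finset.smul_sum, hg, smul_zero,
        sub_zero]
    have hnn : ∀ i ∈ I, 0 ≤ w i - w i₀ / g i₀ * g i := fun i hi => by
      rcases lt_or_ge 0 (g i) with h | h
      · have := hmin i (by simp [hi, h])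
        rw [sub_nonneg, ← le_div_iff₀ h]
        exact this
      · have := mul_nonpos_of_nonneg_of_nonpos hr h
        linarith [hw i]
    obtain ⟨J, hJ, h1, h2⟩ := ih (I.erase i₀) (Finset.erase_ssubset hi₀)
      ⟨fun i => max (w i - w i₀ / g i₀ * g i) 0, fun i => le_max_right _ _, by
        rw [← key]
        exact Finset.sum_congr rfl fun i hi => by
          beta_reduce
          rw [max_eq_left (hnn i (Finset.mem_of_mem_erase hi))]⟩
    exact ⟨J, hJ.trans (Finset.erase_subset _ _), h1, h2⟩

lemma sum_eq_linearCombination (a : ι → E) (J : Finset ι) (w : ι → ℝ) :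
    ∑ i ∈ J, w i • a i =
      Fintype.linearCombination ℝ (fun j : J => a j) (fun j : J => w j) := by
  rw [Fintype.linearCombination_apply, ← Finset.sum_coe_sort J]

lemma exists_coeff_bound (a : ι → E) (J : Finset ι) :
    ∃ C : ℝ, 0 ≤ C ∧ (LinearIndepOn ℝ a (J : Set ι) → ∀ w : ι → ℝ, (∀ i, 0 ≤ w i) →
      ∑ i ∈ J, w i ≤ C * ‖∑ i ∈ J, w i • a i‖) := by
  by_cases hJ : LinearIndepOn ℝ a (J : Set ι)
  swap
  · exact ⟨0, le_rfl, fun h => absurd h hJ⟩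
  obtain ⟨K, -, hK⟩ := (Fintype.linearCombination ℝ (fun j : J => a j)).exists_antilipschitzWith
    (LinearMap.ker_eq_bot.mpr hJ.fintypeLinearCombination_injective)
  refine ⟨J.card * K, by positivity, fun _ w hw => ?_⟩
  have h1 : ‖fun j : J => w j‖ ≤ K * ‖∑ i ∈ J, w i • a i‖ := by
    rw [sum_eq_linearCombination]
    exact hK.le_mul_norm (map_zero _) _
  calc ∑ i ∈ J, w i ≤ ∑ i ∈ J, (K * ‖∑ i ∈ J, w i • a i‖) := by
        refine Finset.sum_le_sum fun i hi => le_trans ?_ h1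
        exact (le_abs_self _).trans (norm_le_pi_norm (fun j : J => w j) ⟨i, hi⟩)
    _ = J.card * K * ‖∑ i ∈ J, w i • a i‖ := by
        rw [Finset.sum_const, nsmul_eq_mul, mul_assoc]

/-- Elements of the cones generated by subfamilies of a finite family have coefficients bounded
linearly in their norm, with a common constant. -/
lemma exists_bounded_coeff (a : ι → E) (S : Finset ι) :
    ∃ C : ℝ, 0 ≤ C ∧ ∀ I ⊆ S, ∀ v ∈ finCone a I,
      ∃ J ⊆ I, ∃ w : ι → ℝ, (∀ i, 0 ≤ w i) ∧ ∑ i ∈ J, w i • a i = v ∧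
        ∑ i ∈ J, w i ≤ C * ‖v‖ := by
  choose C hC h using exists_coeff_bound a
  refine ⟨∑ J ∈ S.powerset, C J, Finset.sum_nonneg fun J _ => hC J, fun I hI v hv => ?_⟩
  obtain ⟨J, hJ, hli, w, hw, rfl⟩ := exists_linearIndepOn_of_mem_finCone a I hv
  refine ⟨J, hJ, w, hw, rfl, (h J hli w hw).trans ?_⟩
  gcongr
  exact Finset.single_le_sum (f := C) (fun J _ => hC J) (by simpa using hJ.trans hI)

/-- A finitely generated cone is closed: it is the union of the finitely many cones generated by its
linearly independent subfamilies, each of which is the image of a closed orthant under a closed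
embedding. -/
lemma isClosed_finCone (a : ι → E) (I : Finset ι) : IsClosed (finCone a I) := by
  have hEq : finCone a I = ⋃ J ∈ {J : Finset ι | J ⊆ I ∧ LinearIndepOn ℝ a (J : Set ι)},
      finCone a J := by
    ext v
    simp only [mem_iUnion, exists_prop, mem_ofPred_eq]
    constructor
    · intro hv
      obtain ⟨J, h1, h2, h3⟩ := exists_linearIndepOn_of_mem_finCone a I hv
      exact ⟨J, ⟨h1, h2⟩, h3⟩
    · rintro ⟨J, ⟨h1, -⟩, h3⟩
      exact finCone_mono a h1 h3
  rw [hEq]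
  have hfin : {J : Finset ι | J ⊆ I ∧ LinearIndepOn ℝ a (J : Set ι)}.Finite :=
    I.powerset.finite_toSet.subset fun J hJ => by simpa using hJ.1
  refine hfin.isClosed_biUnion fun J hJ => ?_
  have hinj : LinearMap.ker (Fintype.linearCombination ℝ (fun j : J => a j)) = ⊥ :=
    LinearMap.ker_eq_bot.mpr hJ.2.fintypeLinearCombination_injective
  have himg : finCone a J = Fintype.linearCombination ℝ (fun j : J => a j) '' Ici 0 := by
    classical
    ext v
    constructor
    · rintro ⟨w, hw, rfl⟩
      exact ⟨fun j => w j, fun j => hw j, (sum_eq_linearCombination a J w).symm⟩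
    · rintro ⟨w, hw, rfl⟩
      refine ⟨fun i => if h : i ∈ J then w ⟨i, h⟩ else 0, fun i => ?_, ?_⟩
      · dsimp only
        split_ifs with h
        · exact hw ⟨i, h⟩
        · exact le_rfl
      · rw [sum_eq_linearCombination]
        congr 1
        ext j
        simp
  rw [himg]
  exact (LinearMap.isClosedEmbedding_of_injective hinj).isClosedMap _ isClosed_Ici

lemma zero_mem_finCone (a : ι → E) (I : Finset ι) : (0 : E) ∈ finCone a I :=
  ⟨0, fun _ => le_rfl, by simp⟩

lemma add_mem_finCone {a : ι → E} {I : Finset ι} {u v : E} (hu : u ∈ finCone a I)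
    (hv : v ∈ finCone a I) : u + v ∈ finCone a I := by
  obtain ⟨w, hw, rfl⟩ := hu
  obtain ⟨w', hw', rfl⟩ := hv
  exact ⟨fun i => w i + w' i, fun i => add_nonneg (hw i) (hw' i), by
    simp only [add_smul, Finset.sum_add_distrib]⟩

lemma smul_mem_finCone {a : ι → E} {I : Finset ι} {u : E} {r : ℝ} (hr : 0 ≤ r)
    (hu : u ∈ finCone a I) : r • u ∈ finCone a I := by
  obtain ⟨w, hw, rfl⟩ := hu
  exact ⟨fun i => r * w i, fun i => mul_nonneg hr (hw i), by
    simp only [mul_smul, Finset.smul_sum]⟩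

lemma mem_finCone_of_mem {a : ι → E} {I : Finset ι} {i : ι} (hi : i ∈ I) : a i ∈ finCone a I := by
  classical
  refine ⟨Pi.single i 1, fun j => ?_, ?_⟩
  · rw [Pi.single_apply]
    split_ifs <;> simp
  · rw [Finset.sum_eq_single i (fun j _ hj => by simp [hj]) (fun h => absurd hi h)]
    simp

/-- Farkas' lemma. -/
lemma exists_separating_of_notMem_finCone [CompleteSpace E] {a : ι → E} {I : Finset ι} {v : E}
    (hv : v ∉ finCone a I) : ∃ d : E, (∀ i ∈ I, ⟪a i, d⟫ ≤ 0) ∧ 0 < ⟪v, d⟫ := by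
  let K : ProperCone ℝ E :=
    { carrier := finCone a I
      add_mem' := add_mem_finCone
      zero_mem' := zero_mem_finCone a I
      smul_mem' := fun c x hx => smul_mem_finCone c.2 hx
      isClosed' := isClosed_finCone a I }
  obtain ⟨y, hy, hvy⟩ := ProperCone.hyperplane_separation' K (x₀ := v) hv
  refine ⟨-y, fun i hi => ?_, by simpa using hvy⟩
  have := hy (a i) (mem_finCone_of_mem hi)
  simpa using this

/-- A set is tangent feasible if each of its tangent directions is a feasible
direction. The tangent direction is given by a sequence that meets the set frequently, so that
the property applies without passing to a subsequence. -/
def TangentFeasible (C : Set E) : Prop :=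
  ∀ (z : ℕ → E) (t : ℕ → ℝ) (zb d : E), zb ∈ C → (∃ᶠ k in atTop, z k ∈ C) → (∀ k, 0 < t k) →
    Tendsto (fun k => (t k)⁻¹ • (z k - zb)) atTop (𝓝 d) → ∀ᶠ s : ℝ in 𝓝[>] 0, zb + s • d ∈ C

/-- The tangent directions of a finitely generated cone `K` at `zb` form the cone generated by `K`
and `-zb`, since the latter is finitely generated, hence closed. -/
lemma tangentFeasible_finCone (a : ι → E) (I : Finset ι) : TangentFeasible (finCone a I) := by
  intro z t zb d hzb hz ht hd
  let a' : Option ι → E := fun o => o.elim (-zb) a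
  have hmem : d ∈ finCone a' I.insertNone := by
    refine (isClosed_finCone a' _).mem_of_frequently_of_tendsto (hz.mono fun k hk => ?_) hd
    obtain ⟨w, hw, hwz⟩ := hk
    refine smul_mem_finCone (inv_nonneg.mpr (ht k).le)
      ⟨fun o => o.elim 1 w, fun o => ?_, ?_⟩
    · cases o <;> simp [hw]
    · simp [Finset.sum_insertNone, a', hwz]
      abel
  obtain ⟨w, hw, rfl⟩ := hmem
  have hpos : ∀ᶠ s : ℝ in 𝓝[>] 0, 0 < 1 - s * w none := by
    have : Tendsto (fun s : ℝ => 1 - s * w none) (𝓝[>] 0) (𝓝 (1 - 0 * w none)) :=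
      ((by fun_prop : Continuous fun s : ℝ => 1 - s * w none).tendsto 0).mono_left
        nhdsWithin_le_nhds
    exact this.eventually (lt_mem_nhds (by simp))
  filter_upwards [hpos, self_mem_nhdsWithin] with s hs hs0
  have h2 : ∑ i ∈ I, w (some i) • a i ∈ finCone a I := ⟨fun i => w (some i), fun i => hw _, rfl⟩
  have h3 := add_mem_finCone (smul_mem_finCone hs.le hzb) (smul_mem_finCone (le_of_lt hs0) h2)
  convert h3 using 1
  simp only [Finset.sum_insertNone, a', Option.elim, smul_add, sub_smul, one_smul, mul_smul,
    smul_neg]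
  abel

end FinCone

/-! ### Polyhedra, their normal cones and Hoffman's error bound -/

section Polyhedra

variable {E : Type*} [NormedAddCommGroup E] [InnerProductSpace ℝ E]

/-- The polyhedron of all `x` with `⟨s.1, x⟩ ≤ s.2` for `s ∈ S`. -/
def polyhedron (S : Finset (E × ℝ)) : Set E := {x | ∀ s ∈ S, ⟪s.1, x⟫ ≤ s.2}

/-- The points of the polyhedron of `S` at which the constraints in `I` are active. -/
def polyFace (S I : Finset (E × ℝ)) : Set E := {x ∈ polyhedron S | ∀ s ∈ I, ⟪s.1, x⟫ = s.2}

open Classical in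
/-- The constraints that are active at `x`. -/
noncomputable def activeSet (S : Finset (E × ℝ)) (x : E) : Finset (E × ℝ) :=
  S.filter fun s => ⟪s.1, x⟫ = s.2

lemma isClosed_polyhedron (S : Finset (E × ℝ)) : IsClosed (polyhedron S) := by
  have : polyhedron S = ⋂ s ∈ S, {x | ⟪s.1, x⟫ ≤ s.2} := by
    ext x
    simp [polyhedron]
  rw [this]
  exact isClosed_biInter fun s _ => isClosed_le (by fun_prop) continuous_const

lemma isClosed_polyFace (S I : Finset (E × ℝ)) : IsClosed (polyFace S I) := by
  have : polyFace S I = polyhedron S ∩ ⋂ s ∈ I, {x | ⟪s.1, x⟫ = s.2} := by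
    ext x
    simp [polyFace]
  rw [this]
  exact (isClosed_polyhedron S).inter
    (isClosed_biInter fun s _ => isClosed_eq (by fun_prop) continuous_const)

lemma convex_polyhedron (S : Finset (E × ℝ)) : Convex ℝ (polyhedron S) := by
  intro x hx y hy r q hr hq hrq s hs
  rw [inner_add_right, inner_smul_right, inner_smul_right]
  calc r * ⟪s.1, x⟫ + q * ⟪s.1, y⟫ ≤ r * s.2 + q * s.2 := by
        have := hx s hs
        have := hy s hs
        gcongr
    _ = s.2 := by rw [← add_mul, hrq, one_mul]

lemma activeSet_subset (S : Finset (E × ℝ)) (x : E) : activeSet S x ⊆ S := Finset.filter_subset _ _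

lemma mem_polyFace_activeSet {S : Finset (E × ℝ)} {x : E} (hx : x ∈ polyhedron S) :
    x ∈ polyFace S (activeSet S x) :=
  ⟨hx, fun _ hs => (Finset.mem_filter.mp hs).2⟩

/-- A direction that is nonincreasing for the active constraints and zero for the prescribed ones
is feasible for a face. -/
lemma eventually_add_smul_mem_polyFace {S I : Finset (E × ℝ)} {x d : E} (hx : x ∈ polyFace S I)
    (hd : ∀ s ∈ activeSet S x, ⟪s.1, d⟫ ≤ 0) (hd0 : ∀ s ∈ I, ⟪s.1, d⟫ = 0) :
    ∀ᶠ t : ℝ in 𝓝[>] 0, x + t • d ∈ polyFace S I := by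
  have h1 : ∀ s ∈ S, ∀ᶠ t : ℝ in 𝓝[>] 0, ⟪s.1, x + t • d⟫ ≤ s.2 := by
    intro s hs
    rcases (hx.1 s hs).lt_or_eq with h | h
    · have : Tendsto (fun t : ℝ => ⟪s.1, x + t • d⟫) (𝓝[>] 0) (𝓝 ⟪s.1, x + (0 : ℝ) • d⟫) :=
        ((by fun_prop : Continuous fun t : ℝ => ⟪s.1, x + t • d⟫).tendsto 0).mono_left
          nhdsWithin_le_nhds
      refine (this.eventually (gt_mem_nhds ?_)).mono fun t ht => le_of_lt ht
      simpa using h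
    · filter_upwards [self_mem_nhdsWithin] with t ht
      rw [inner_add_right, inner_smul_right, h]
      have := mul_nonpos_of_nonneg_of_nonpos (le_of_lt ht)
        (hd s (Finset.mem_filter.mpr ⟨hs, h⟩))
      linarith
  filter_upwards [(Finset.eventually_all S).mpr h1] with t ht
  exact ⟨ht, fun s hs => by
    rw [inner_add_right, inner_smul_right, hd0 s hs, hx.2 s hs, mul_zero, add_zero]⟩

lemma tangentFeasible_polyFace (S I : Finset (E × ℝ)) : TangentFeasible (polyFace S I) := by
  intro z t zb d hzb hz ht hd
  have hlim : ∀ v : E, Tendsto (fun k => ⟪v, (t k)⁻¹ • (z k - zb)⟫) atTop (𝓝 ⟪v, d⟫) :=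
    fun v => tendsto_const_nhds.inner hd
  refine eventually_add_smul_mem_polyFace hzb (fun s hs => ?_) (fun s hs => ?_)
  · obtain ⟨hsS, hact⟩ := Finset.mem_filter.mp hs
    refine isClosed_Iic.mem_of_frequently_of_tendsto (hz.mono fun k hk => ?_) (hlim s.1)
    rw [mem_Iic, inner_smul_right, inner_sub_right, hact]
    exact mul_nonpos_of_nonneg_of_nonpos (inv_nonneg.mpr (ht k).le)
      (by linarith [hk.1 s hsS])
  · refine (isClosed_singleton (x := (0 : ℝ))).mem_of_frequently_of_tendsto
      (hz.mono fun k hk => ?_) (hlim s.1)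
    rw [mem_singleton_iff, inner_smul_right, inner_sub_right, hzb.2 s hs, hk.2 s hs, sub_self,
      mul_zero]

/-- The normal cone of a polyhedron is generated by the active constraint vectors. -/
lemma mem_finCone_activeSet [CompleteSpace E] {S : Finset (E × ℝ)} {x v : E}
    (hx : x ∈ polyhedron S) (hv : ∀ u ∈ polyhedron S, ⟪v, u - x⟫ ≤ 0) :
    v ∈ finCone Prod.fst (activeSet S x) := by
  by_contra hcon
  obtain ⟨d, hd, hvd⟩ := exists_separating_of_notMem_finCone hcon
  have hface : x ∈ polyFace S ∅ := ⟨hx, by simp⟩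
  obtain ⟨t, ht, ht0⟩ :=
    ((eventually_add_smul_mem_polyFace hface hd (by simp)).and self_mem_nhdsWithin).exists
  have := hv _ ht.1
  rw [add_sub_cancel_left, inner_smul_right] at this
  exact absurd this (not_le.mpr (mul_pos ht0 hvd))

lemma inner_sub_nonpos_of_mem_finCone {S I : Finset (E × ℝ)} (hI : I ⊆ S) {x v u : E}
    (hx : x ∈ polyFace S I) (hv : v ∈ finCone Prod.fst I) (hu : u ∈ polyhedron S) :
    ⟪v, u - x⟫ ≤ 0 := by
  obtain ⟨w, hw, rfl⟩ := hv
  rw [sum_inner]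
  refine Finset.sum_nonpos fun s hs => ?_
  rw [real_inner_smul_left, inner_sub_right, hx.2 s hs]
  exact mul_nonpos_of_nonneg_of_nonpos (hw s) (by linarith [hu s (hI hs)])

/-- Hoffman's lemma: the distance to a polyhedron is bounded by the violation of its constraints.
The displacement to the nearest point lies in the normal cone there, and the coefficients of its
representation by active constraint vectors are bounded. -/
lemma exists_hoffman_bound [FiniteDimensional ℝ E] (S : Finset (E × ℝ))
    (hne : (polyhedron S).Nonempty) :
    ∃ H : ℝ, 0 ≤ H ∧ ∀ (x : E) (r : ℝ), (∀ s ∈ S, ⟪s.1, x⟫ ≤ s.2 + r) →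
      ∃ x' ∈ polyhedron S, ‖x - x'‖ ≤ H * |r| := by
  have : CompleteSpace E := FiniteDimensional.complete ℝ E
  obtain ⟨C, hC, hrep⟩ := exists_bounded_coeff (Prod.fst : E × ℝ → E) S
  refine ⟨C, hC, fun x r hx => ?_⟩
  obtain ⟨x', hx', hmin⟩ := exists_norm_eq_iInf_of_complete_convex hne
    (isClosed_polyhedron S).isComplete (convex_polyhedron S) x
  rw [norm_eq_iInf_iff_real_inner_le_zero (convex_polyhedron S) hx'] at hmin
  refine ⟨x', hx', ?_⟩
  obtain ⟨J, hJ, w, hw, hsum, hbd⟩ := hrep _ (activeSet_subset S x') _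
    (mem_finCone_activeSet hx' hmin)
  have h1 : ‖x - x'‖ * ‖x - x'‖ ≤ C * |r| * ‖x - x'‖ :=
    calc ‖x - x'‖ * ‖x - x'‖ = ⟪∑ s ∈ J, w s • s.1, x - x'⟫ := by
          rw [hsum, real_inner_self_eq_norm_mul_norm]
      _ ≤ ∑ s ∈ J, w s * |r| := by
          rw [sum_inner]
          refine Finset.sum_le_sum fun s hs => ?_
          obtain ⟨hsS, hact⟩ := Finset.mem_filter.mp (hJ hs)
          rw [real_inner_smul_left, inner_sub_right, hact]
          have := hx s hsS
          have := le_abs_self r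
          exact mul_le_mul_of_nonneg_left (by linarith) (hw s)
      _ ≤ C * ‖x - x'‖ * |r| := by
          rw [← Finset.sum_mul]
          gcongr
      _ = C * |r| * ‖x - x'‖ := by ring
  rcases (norm_nonneg (x - x')).eq_or_lt with h | h
  · rw [← h]
    positivity
  · exact le_of_mul_le_mul_right h1 h

/-- On the set `C`, the residual `‖B x - B xb‖` bounds the distance to the solutions in `C` of the
linear equation `B x' = B xb`. -/
def HasLinearErrorBound {F : Type*} [NormedAddCommGroup F] [InnerProductSpace ℝ F] (C : Set E)
    (B : E →ₗ[ℝ] F) (xb : E) : Prop :=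
  ∃ H : ℝ, 0 ≤ H ∧ ∀ x ∈ C, ∃ x' ∈ C, B x' = B xb ∧ ‖x - x'‖ ≤ H * ‖B x - B xb‖

variable {F : Type*} [NormedAddCommGroup F] [InnerProductSpace ℝ F]
  [FiniteDimensional ℝ F]

lemma hasLinearErrorBound_polyhedron [FiniteDimensional ℝ E] (S : Finset (E × ℝ)) (B : E →ₗ[ℝ] F)
    {xb : E} (hxb : xb ∈ polyhedron S) : HasLinearErrorBound (polyhedron S) B xb := by
  classical
  let e := stdOrthonormalBasis ℝ F
  let g : Fin (Module.finrank ℝ F) → E × ℝ := fun j => (LinearMap.adjoint B (e j), ⟪e j, B xb⟫)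
  let S' : Finset (E × ℝ) :=
    S ∪ (Finset.univ.image g ∪ Finset.univ.image fun j => -g j)
  have hS' : ∀ (x : E) (r : ℝ), (∀ s ∈ S', ⟪s.1, x⟫ ≤ s.2 + r) ↔
      (∀ s ∈ S, ⟪s.1, x⟫ ≤ s.2 + r) ∧ ∀ j, |⟪e j, B x - B xb⟫| ≤ r := by
    intro x r
    simp only [S', Finset.forall_mem_union, Finset.forall_mem_image, Finset.mem_univ, true_implies,
      ← forall_and, abs_le]
    refine and_congr_right fun _ => forall_congr' fun j => ?_
    simp only [g, Prod.fst_neg, Prod.snd_neg, inner_neg_left, LinearMap.adjoint_inner_left,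
      inner_sub_right]
    constructor <;> rintro ⟨h1, h2⟩ <;> constructor <;> linarith
  have hpoly : ∀ x, x ∈ polyhedron S' ↔ x ∈ polyhedron S ∧ B x = B xb := by
    intro x
    have h0 := hS' x 0
    simp only [add_zero, abs_nonpos_iff] at h0
    refine h0.trans (and_congr_right fun _ => ?_)
    rw [← sub_eq_zero (a := B x)]
    constructor
    · intro h
      refine e.repr.map_eq_zero_iff.mp ?_
      ext j
      simpa [e.repr_apply_apply, inner_sub_right] using h j
    · intro h j
      rw [h, inner_zero_right]
  obtain ⟨H, hH, hb⟩ := exists_hoffman_bound S' ⟨xb, (hpoly xb).mpr ⟨hxb, rfl⟩⟩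
  refine ⟨H, hH, fun x hx => ?_⟩
  obtain ⟨x', hx', hle⟩ := hb x ‖B x - B xb‖ <| (hS' _ _).mpr
    ⟨fun s hs => (hx s hs).trans (by simp), fun j => by
      simpa using abs_real_inner_le_norm (e j) (B x - B xb)⟩
  exact ⟨x', ((hpoly x').mp hx').1, ((hpoly x').mp hx').2, by simpa using hle⟩

/-- The error bound for a finitely generated cone follows from the one for the nonnegative orthant
of coefficients. -/
lemma hasLinearErrorBound_finCone {ι : Type*} (a : ι → E) (I : Finset ι) (B : E →ₗ[ℝ] F) {xb : E}
    (hxb : xb ∈ finCone a I) : HasLinearErrorBound (finCone a I) B xb := by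
  classical
  let S : Finset (EuclideanSpace ℝ I × ℝ) :=
    Finset.univ.image fun j => (-EuclideanSpace.single j (1 : ℝ), (0 : ℝ))
  have hS : ∀ w, w ∈ polyhedron S ↔ ∀ j, 0 ≤ w j := by
    intro w
    refine Finset.forall_mem_image.trans ?_
    simp [EuclideanSpace.inner_single_left]
  let L : EuclideanSpace ℝ I →ₗ[ℝ] E :=
    Fintype.linearCombination ℝ (fun j : I => a j) ∘ₗ (WithLp.linearEquiv 2 ℝ (I → ℝ)).toLinearMap
  have hL : ∀ w, L w = ∑ j : I, w j • a j := fun w => by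
    simp [L, Fintype.linearCombination_apply]
  have hcone : ∀ v, v ∈ finCone a I ↔ ∃ w ∈ polyhedron S, L w = v := by
    intro v
    constructor
    · rintro ⟨w, hw, rfl⟩
      refine ⟨WithLp.toLp 2 fun j : I => w j, (hS _).mpr fun j => hw j, ?_⟩
      rw [hL, ← Finset.sum_coe_sort I]
    · rintro ⟨w, hw, rfl⟩
      refine ⟨fun i => if h : i ∈ I then w ⟨i, h⟩ else 0, fun i => ?_, ?_⟩
      · dsimp only
        split_ifs with h
        · exact (hS w).mp hw ⟨i, h⟩
        · exact le_rfl
      · rw [hL, ← Finset.sum_coe_sort I]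
        exact Finset.sum_congr rfl fun j _ => by simp
  obtain ⟨wb, hwb, rfl⟩ := (hcone xb).mp hxb
  obtain ⟨H, hH, hb⟩ := hasLinearErrorBound_polyhedron S (B ∘ₗ L) hwb
  refine ⟨‖L.toContinuousLinearMap‖ * H, by positivity, fun x hx => ?_⟩
  obtain ⟨w, hw, rfl⟩ := (hcone x).mp hx
  obtain ⟨w', hw', hBw', hle⟩ := hb w hw
  refine ⟨L w', (hcone _).mpr ⟨w', hw', rfl⟩, hBw', ?_⟩
  calc ‖L w - L w'‖ = ‖L.toContinuousLinearMap (w - w')‖ := by simp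
    _ ≤ ‖L.toContinuousLinearMap‖ * ‖w - w'‖ := L.toContinuousLinearMap.le_opNorm _
    _ ≤ ‖L.toContinuousLinearMap‖ * (H * ‖B (L w) - B (L wb)‖) := by
        gcongr
        exact hle
    _ = ‖L.toContinuousLinearMap‖ * H * ‖B (L w) - B (L wb)‖ := by ring

end Polyhedra

/-! ### Subgradients of extended-real-valued functions -/

section Subgradients

lemma coe_toReal_of_mem_effDom {E : Type*} {f : E → EReal} (hbot : ∀ x, f x ≠ ⊥)
    {x : E} (hx : x ∈ effDom f) : ((f x).toReal : EReal) = f x :=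
  EReal.coe_toReal (ne_of_lt hx) (hbot x)

variable {E : Type*} [NormedAddCommGroup E] [InnerProductSpace ℝ E]

lemma mem_effDom_of_mem_subdiff {f : E → EReal} (hf : IsProper f) {x v : E}
    (hv : v ∈ subdiff f x) : x ∈ effDom f := by
  obtain ⟨u, hu⟩ := hf.2
  have h := hv u
  by_contra hx
  have htop : f x = ⊤ := not_lt_top_iff.mp hx
  rw [htop, EReal.top_add_coe, top_le_iff] at h
  exact (ne_of_lt hu) h

/-- The subgradient inequality between two points of the effective domain, in real terms. -/
lemma toReal_add_inner_le {f : E → EReal} (hf : IsProper f) {x v u : E} (hv : v ∈ subdiff f x)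
    (hu : u ∈ effDom f) : (f x).toReal + ⟪v, u - x⟫ ≤ (f u).toReal := by
  have h := hv u
  rw [← coe_toReal_of_mem_effDom hf.1 (mem_effDom_of_mem_subdiff hf hv),
    ← coe_toReal_of_mem_effDom hf.1 hu] at h
  exact_mod_cast h

lemma mem_subdiff_of_forall_toReal {f : E → EReal} (hbot : ∀ x, f x ≠ ⊥) {x v : E}
    (hx : x ∈ effDom f) (h : ∀ u ∈ effDom f, (f x).toReal + ⟪v, u - x⟫ ≤ (f u).toReal) :
    v ∈ subdiff f x := by
  intro u
  by_cases hu : u ∈ effDom f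
  · rw [← coe_toReal_of_mem_effDom hbot hx, ← coe_toReal_of_mem_effDom hbot hu]
    exact_mod_cast h u hu
  · have htop : f u = ⊤ := not_lt_top_iff.mp hu
    rw [htop]
    exact le_top

/-- The subdifferential is monotone. -/
lemma inner_sub_nonneg_of_mem_subdiff {f : E → EReal} (hf : IsProper f) {x₁ x₂ v₁ v₂ : E}
    (h₁ : v₁ ∈ subdiff f x₁) (h₂ : v₂ ∈ subdiff f x₂) : 0 ≤ ⟪v₁ - v₂, x₁ - x₂⟫ := by
  have h1 := toReal_add_inner_le hf h₁ (mem_effDom_of_mem_subdiff hf h₂)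
  have h2 := toReal_add_inner_le hf h₂ (mem_effDom_of_mem_subdiff hf h₁)
  rw [← neg_sub x₁ x₂, inner_neg_right] at h1
  rw [inner_sub_left]
  linarith

/-- If `v` stays a subgradient along a ray near `x`, then `f` is affine there with slope `v`. -/
lemma hasDirDerivE_of_eventually_mem_subdiff {f : E → EReal} (hf : IsProper f) {x v d : E}
    (hv : v ∈ subdiff f x) (h : ∀ᶠ t : ℝ in 𝓝[>] 0, v ∈ subdiff f (x + t • d)) :
    HasDirDerivE f x d ((⟪v, d⟫ : ℝ) : EReal) ∧ d ∈ posTangentConeAt (effDom f) x := by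
  refine ⟨?_, mem_posTangentConeAt_of_frequently_mem
    (h.frequently.mono fun t ht => mem_effDom_of_mem_subdiff hf ht)⟩
  refine tendsto_const_nhds.congr' ?_
  filter_upwards [h, self_mem_nhdsWithin] with t ht ht0
  have ht0' : (0 : ℝ) < t := ht0
  have hx := mem_effDom_of_mem_subdiff hf hv
  have hxt := mem_effDom_of_mem_subdiff hf ht
  have h1 := toReal_add_inner_le hf hv hxt
  have h2 := toReal_add_inner_le hf ht hx
  rw [add_sub_cancel_left, inner_smul_right] at h1
  rw [sub_add_cancel_left, inner_neg_right, inner_smul_right] at h2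
  have h3 : ⟪v, d⟫ = ((f (x + t • d)).toReal - (f x).toReal) / t := by
    rw [eq_div_iff ht0'.ne']
    linarith
  rw [← coe_toReal_of_mem_effDom hf.1 hx, ← coe_toReal_of_mem_effDom hf.1 hxt, h3,
    EReal.coe_div, EReal.coe_sub]

lemma convexOn_toReal {f : E → EReal} (hbot : ∀ x, f x ≠ ⊥) (hf : IsConvexFun f) :
    ConvexOn ℝ (effDom f) fun x => (f x).toReal := by
  have key : ∀ x ∈ effDom f, ∀ y ∈ effDom f, ∀ a b : ℝ, 0 ≤ a → 0 ≤ b → a + b = 1 →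
      f (a • x + b • y) ≤ ((a * (f x).toReal + b * (f y).toReal : ℝ) : EReal) := by
    intro x hx y hy a b ha hb hab
    exact hf (x := (x, (f x).toReal)) (coe_toReal_of_mem_effDom hbot hx).ge
      (y := (y, (f y).toReal)) (coe_toReal_of_mem_effDom hbot hy).ge ha hb hab
  have hdom : Convex ℝ (effDom f) := fun x hx y hy a b ha hb hab =>
    (key x hx y hy a b ha hb hab).trans_lt (EReal.coe_lt_top _)
  refine ⟨hdom, fun x hx y hy a b ha hb hab => ?_⟩
  have h := key x hx y hy a b ha hb hab
  rw [← coe_toReal_of_mem_effDom hbot (hdom hx hy ha hb hab)] at h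
  exact_mod_cast h

variable [FiniteDimensional ℝ E]

lemma hasFDerivAt_toReal {f : E → EReal} {x : E}
    (hd : DifferentiableAt ℝ (fun u => (f u).toReal) x) :
    HasFDerivAt (fun u => (f u).toReal) (innerSL ℝ (grad f x)) x := by
  have : CompleteSpace E := FiniteDimensional.complete ℝ E
  exact hd.hasGradientAt.hasFDerivAt

lemma grad_mem_subdiff {f : E → EReal} (hbot : ∀ x, f x ≠ ⊥) (hf : IsConvexFun f) {x : E}
    (hx : x ∈ effDom f) (hd : DifferentiableAt ℝ (fun u => (f u).toReal) x) :
    grad f x ∈ subdiff f x := by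
  refine mem_subdiff_of_forall_toReal hbot hx fun u hu => ?_
  have hlim := (hasFDerivAt_toReal hd).hasLineDerivAt (u - x)
  have hlim' : Tendsto (fun t : ℝ => t⁻¹ • ((f (x + t • (u - x))).toReal - (f x).toReal))
      (𝓝[>] 0) (𝓝 ⟪grad f x, u - x⟫) := hlim.tendsto_slope_zero_right
  have hle : ⟪grad f x, u - x⟫ ≤ (f u).toReal - (f x).toReal := by
    refine le_of_tendsto hlim' ?_
    filter_upwards [Ioc_mem_nhdsGT one_pos] with t ht
    have h := (convexOn_toReal hbot hf).2 hx hu (sub_nonneg.mpr ht.2) ht.1.le (by ring)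
    have hpt : (1 - t) • x + t • u = x + t • (u - x) := by
      rw [sub_smul, one_smul, smul_sub]
      abel
    simp only [hpt, smul_eq_mul] at h ⊢
    rw [inv_mul_le_iff₀ ht.1]
    linarith
  linarith

lemma eq_grad_of_mem_subdiff {f : E → EReal} (hf : IsProper f) {x v : E}
    (hx : x ∈ interior (effDom f)) (hd : DifferentiableAt ℝ (fun u => (f u).toReal) x)
    (hv : v ∈ subdiff f x) : v = grad f x := by
  have hmin : IsLocalMin (fun u => (f u).toReal - ⟪v, u⟫) x := by
    filter_upwards [mem_interior_iff_mem_nhds.mp hx] with u hu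
    have := toReal_add_inner_le hf hv hu
    rw [inner_sub_right] at this
    linarith
  have hz := hmin.hasFDerivAt_eq_zero ((hasFDerivAt_toReal hd).sub (innerSL ℝ v).hasFDerivAt)
  have h2 := congrArg (fun T : E →L[ℝ] ℝ => T (grad f x - v)) hz
  simp only [sub_apply, innerSL_apply_apply, zero_apply,
    ← inner_sub_left, inner_self_eq_zero] at h2
  exact (sub_eq_zero.mp h2).symm

/-- An essentially smooth function has no subgradients outside the interior of its domain. On the
segment from a point with a subgradient to an interior point `x₀` the gradients stay bounded: their
components along the segment are bounded below by monotonicity, and their norms are then bounded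
because the function is bounded above near `x₀`. -/
lemma mem_interior_of_mem_subdiff {f : E → EReal} (hf : EssentiallySmooth f) {x v : E}
    (hv : v ∈ subdiff f x) : x ∈ interior (effDom f) := by
  by_contra hx
  have hbot := hf.proper.1
  have hxd := mem_effDom_of_mem_subdiff hf.proper hv
  obtain ⟨x₀, hx₀⟩ := hf.nonempty_interior
  have hconv := (convexOn_toReal hbot hf.convex).1
  let t : ℕ → ℝ := fun k => 1 / ((k : ℝ) + 1)
  have ht0 : ∀ k, 0 < t k := fun k => by positivity
  have ht1 : ∀ k, t k ≤ 1 := fun k => by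
    rw [div_le_one (by positivity)]
    simp
  have htlim : Tendsto t atTop (𝓝 0) := tendsto_one_div_add_atTop_nhds_zero_nat
  let s : ℕ → E := fun k => x + t k • (x₀ - x)
  have hs : ∀ k, s k ∈ interior (effDom f) := fun k => by
    have := hconv.add_smul_sub_mem_interior hxd hx₀ (t := t k) ⟨ht0 k, ht1 k⟩
    exact this
  have hslim : Tendsto s atTop (𝓝 x) := by
    simpa using (tendsto_const_nhds (x := x)).add (htlim.smul_const (x₀ - x))
  have hfr : x ∈ frontier (interior (effDom f)) := by
    rw [isOpen_interior.frontier_eq]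
    exact ⟨mem_closure_of_tendsto hslim (Eventually.of_forall hs), hx⟩
  have hgrad := hf.tendsto_norm_grad s x hs hfr hslim
  obtain ⟨ε, hε, hball⟩ : ∃ ε > 0, ∀ u, dist u x₀ ≤ ε →
      u ∈ effDom f ∧ (f u).toReal ≤ (f x₀).toReal + 1 := by
    have h1 : ∀ᶠ u in 𝓝 x₀, u ∈ effDom f ∧ (f u).toReal ≤ (f x₀).toReal + 1 := by
      have hc := (hf.differentiableAt x₀ hx₀).continuousAt
      filter_upwards [mem_interior_iff_mem_nhds.mp hx₀,
        hc.eventually (gt_mem_nhds (lt_add_one (f x₀).toReal))] with u h1 h2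
      exact ⟨h1, le_of_lt h2⟩
    obtain ⟨ε, hε, h⟩ := Metric.nhds_basis_closedBall.eventually_iff.mp h1
    exact ⟨ε, hε, fun u hu => h hu⟩
  have hbd : ∀ k, ‖grad f (s k)‖ ≤
      ((f x₀).toReal + 1 - (f x).toReal + 2 * ‖v‖ * ‖x₀ - x‖) / ε := by
    intro k
    have hgk := grad_mem_subdiff hbot hf.convex (interior_subset (hs k))
      (hf.differentiableAt _ (hs k))
    set g := grad f (s k) with hg
    rcases eq_or_ne g 0 with h0 | h0
    · rw [h0, norm_zero]
      have h1 := toReal_add_inner_le hf.proper hv (interior_subset hx₀)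
      have h2 := abs_real_inner_le_norm v (x₀ - x)
      have h3 := neg_abs_le ⟪v, x₀ - x⟫
      have h4 : 0 ≤ ‖v‖ * ‖x₀ - x‖ := by positivity
      apply div_nonneg _ hε.le
      linarith
    rw [le_div_iff₀ hε]
    have hgn : 0 < ‖g‖ := norm_pos_iff.mpr h0
    -- the subgradient inequality at the point of the ball farthest in the direction of `g`
    have hfar := hball (x₀ + (ε / ‖g‖) • g) (by
      rw [dist_eq_norm, add_sub_cancel_left, norm_smul, Real.norm_of_nonneg (by positivity),
        div_mul_cancel₀ _ hgn.ne'])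
    have h1 := toReal_add_inner_le hf.proper hgk hfar.1
    have h2 := toReal_add_inner_le hf.proper hv (interior_subset (hs k))
    have h3 := inner_sub_nonneg_of_mem_subdiff hf.proper hgk hv
    have hsx : s k - x = t k • (x₀ - x) := by simp [s]
    rw [hsx, inner_smul_right] at h2 h3
    have h4 : 0 ≤ ⟪g - v, x₀ - x⟫ := nonneg_of_mul_nonneg_right h3 (ht0 k)
    have h5 : x₀ + (ε / ‖g‖) • g - s k = (1 - t k) • (x₀ - x) + (ε / ‖g‖) • g := by
      simp only [s, sub_smul, one_smul]
      abel
    have h6 : ε / ‖g‖ * ⟪g, g⟫ = ‖g‖ * ε := by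
      rw [real_inner_self_eq_norm_mul_norm]
      field_simp
    rw [h5, inner_add_right, inner_smul_right, inner_smul_right, h6] at h1
    rw [inner_sub_left] at h4
    have h7 : (1 - t k) * ⟪v, x₀ - x⟫ ≤ (1 - t k) * ⟪g, x₀ - x⟫ :=
      mul_le_mul_of_nonneg_left (by linarith) (by linarith [ht1 k])
    have h8 := neg_abs_le ⟪v, x₀ - x⟫
    have h9 := abs_real_inner_le_norm v (x₀ - x)
    have h10 : 0 ≤ ‖v‖ * ‖x₀ - x‖ := by positivity
    linarith [hfar.2]
  obtain ⟨k, hk⟩ := (hgrad.eventually_gt_atTop _).exists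
  exact absurd (hbd k) (not_le.mpr hk)

end Subgradients

/-! ### Subdifferentials of polyhedral indicator and support functions -/

section PiecewiseSubdiff

lemma isProper_indicatorFun {E : Type*} {P : Set E} (hP : P.Nonempty) :
    IsProper (indicatorFun P) := by
  refine ⟨fun x => ?_, ?_⟩
  · unfold indicatorFun
    split_ifs <;> simp
  · obtain ⟨x, hx⟩ := hP
    exact ⟨x, by simp [effDom, indicatorFun, hx]⟩

variable {E : Type*} [NormedAddCommGroup E] [InnerProductSpace ℝ E]

/-- The graph of the subdifferential of `f` is the union of the finitely many products
`C I ×ˢ D I`, `I ⊆ S`, where all `C I` and `D I` are closed and the tangent directions of `C I`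
are feasible. -/
structure HasPiecewiseSubdiff (f : E → EReal) (S : Finset (E × ℝ))
    (C D : Finset (E × ℝ) → Set E) : Prop where
  mem_subdiff_iff : ∀ z x, x ∈ subdiff f z ↔ ∃ I ⊆ S, z ∈ C I ∧ x ∈ D I
  isClosed_left : ∀ I, IsClosed (C I)
  isClosed_right : ∀ I, IsClosed (D I)
  tangentFeasible : ∀ I, TangentFeasible (C I)

namespace HasPiecewiseSubdiff

variable {f : E → EReal} {S : Finset (E × ℝ)} {C D : Finset (E × ℝ) → Set E}

lemma eventually_subdiff_subset (hf : HasPiecewiseSubdiff f S C D) (zb : E) :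
    ∀ᶠ z in 𝓝 zb, subdiff f z ⊆ subdiff f zb := by
  have h1 : ∀ I ∈ S.powerset, ∀ᶠ z in 𝓝 zb, z ∈ C I → zb ∈ C I := by
    intro I _
    by_cases h : zb ∈ C I
    · exact Eventually.of_forall fun _ _ => h
    · filter_upwards [(hf.isClosed_left I).isOpen_compl.mem_nhds h] with z hz hz'
      exact absurd hz' hz
  filter_upwards [(Finset.eventually_all S.powerset).mpr h1] with z hz x hx
  obtain ⟨I, hI, hzI, hxI⟩ := (hf.mem_subdiff_iff z x).mp hx
  exact (hf.mem_subdiff_iff zb x).mpr ⟨I, hI, hz I (by simpa using hI) hzI, hxI⟩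

lemma eventually_mem_subdiff_ray (hf : HasPiecewiseSubdiff f S C D) {z x : ℕ → E} {t : ℕ → ℝ}
    {zb xb d : E} (hmem : ∀ k, x k ∈ subdiff f (z k)) (hz : Tendsto z atTop (𝓝 zb))
    (hx : Tendsto x atTop (𝓝 xb)) (ht : ∀ k, 0 < t k)
    (hd : Tendsto (fun k => (t k)⁻¹ • (z k - zb)) atTop (𝓝 d)) :
    xb ∈ subdiff f zb ∧ ∀ᶠ s : ℝ in 𝓝[>] 0, xb ∈ subdiff f (zb + s • d) := by
  choose I hI hzI hxI using fun k => (hf.mem_subdiff_iff (z k) (x k)).mp (hmem k)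
  -- infinitely many points of the sequence lie in the same piece
  obtain ⟨J, hJ, hfreq⟩ : ∃ J ⊆ S, ∃ᶠ k in atTop, I k = J := by
    by_contra hcon
    push Not at hcon
    have h1 : ∀ J ∈ S.powerset, ∀ᶠ k in atTop, I k ≠ J := fun J hJ =>
      hcon J (by simpa using hJ)
    obtain ⟨k, hk⟩ := ((Finset.eventually_all S.powerset).mpr h1).exists
    exact hk (I k) (by simpa using hI k) rfl
  have hzJ : ∃ᶠ k in atTop, z k ∈ C J := hfreq.mono fun k hk => hk ▸ hzI k
  have hzb : zb ∈ C J := (hf.isClosed_left J).mem_of_frequently_of_tendsto hzJ hz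
  have hxb : xb ∈ D J := (hf.isClosed_right J).mem_of_frequently_of_tendsto
    (hfreq.mono fun k hk => hk ▸ hxI k) hx
  refine ⟨(hf.mem_subdiff_iff _ _).mpr ⟨J, hJ, hzb, hxb⟩, ?_⟩
  filter_upwards [hf.tangentFeasible J z t zb d hzb hzJ ht hd] with s hs
  exact (hf.mem_subdiff_iff _ _).mpr ⟨J, hJ, hs, hxb⟩

end HasPiecewiseSubdiff

lemma coe_inner_le_supportFun {P : Set E} {x : E} (hx : x ∈ P) (z : E) :
    ((⟪x, z⟫ : ℝ) : EReal) ≤ supportFun P z :=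
  le_iSup₂ (f := fun (x : E) (_ : x ∈ P) => ((⟪x, z⟫ : ℝ) : EReal)) x hx

lemma supportFun_le_coe_iff {P : Set E} {z : E} {r : ℝ} :
    supportFun P z ≤ (r : EReal) ↔ ∀ x ∈ P, ⟪x, z⟫ ≤ r := by
  simp only [supportFun, iSup_le_iff, EReal.coe_le_coe_iff]

lemma isProper_supportFun {P : Set E} (hP : P.Nonempty) : IsProper (supportFun P) := by
  refine ⟨fun z => ?_, 0, ?_⟩
  · obtain ⟨x, hx⟩ := hP
    exact ((EReal.bot_lt_coe _).trans_le (coe_inner_le_supportFun hx z)).ne'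
  · refine lt_of_le_of_lt (supportFun_le_coe_iff (r := 0).mpr fun x _ => ?_) (EReal.coe_lt_top _)
    simp

lemma mem_subdiff_indicatorFun_iff {P : Set E} (hP : P.Nonempty) {z x : E} :
    x ∈ subdiff (indicatorFun P) z ↔ z ∈ P ∧ ∀ u ∈ P, ⟪x, u - z⟫ ≤ 0 := by
  constructor
  · intro hx
    have hdom := mem_effDom_of_mem_subdiff (isProper_indicatorFun hP) hx
    have hz : z ∈ P := by
      by_contra h
      simp [effDom, indicatorFun, h] at hdom
    refine ⟨hz, fun u hu => ?_⟩
    have := hx u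
    simp only [indicatorFun, hz, hu, if_true, zero_add] at this
    exact_mod_cast this
  · rintro ⟨hz, h⟩ u
    by_cases hu : u ∈ P
    · simp only [indicatorFun, hz, hu, if_true, zero_add]
      exact_mod_cast h u hu
    · simp [indicatorFun, hu]

/-- The subgradients of the support function of a polyhedron at `z` are the points of the polyhedron
that maximize `⟨·, z⟩`. A subgradient satisfies each constraint because the support function is
subadditive and bounded by the right-hand side at the constraint vector. -/
lemma mem_subdiff_supportFun_iff {S : Finset (E × ℝ)} (hP : (polyhedron S).Nonempty) {z x : E} :
    x ∈ subdiff (supportFun (polyhedron S)) z ↔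
      x ∈ polyhedron S ∧ ∀ u ∈ polyhedron S, ⟪z, u - x⟫ ≤ 0 := by
  have hprop := isProper_supportFun hP
  constructor
  · intro hx
    have hdom := mem_effDom_of_mem_subdiff hprop hx
    have hval := coe_toReal_of_mem_effDom hprop.1 hdom
    have hle : ∀ u ∈ polyhedron S, ⟪u, z⟫ ≤ (supportFun (polyhedron S) z).toReal :=
      supportFun_le_coe_iff.mp hval.ge
    have hsub : ∀ (u : E) (r : ℝ), (∀ w ∈ polyhedron S, ⟪w, u⟫ ≤ r) →
        (supportFun (polyhedron S) z).toReal + ⟪x, u - z⟫ ≤ r := by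
      intro u r hu
      have h1 := (hx u).trans (supportFun_le_coe_iff.mpr hu)
      rw [← hval] at h1
      exact_mod_cast h1
    refine ⟨fun s hs => ?_, fun u hu => ?_⟩
    · have h1 := hsub (z + s.1) ((supportFun (polyhedron S) z).toReal + s.2) fun w hw => by
        rw [inner_add_right, real_inner_comm s.1 w]
        exact add_le_add (hle w hw) (hw s hs)
      rw [add_sub_cancel_left, real_inner_comm s.1 x] at h1
      linarith
    · have h1 := hsub 0 0 fun w _ => by simp
      have h2 := hle u hu
      rw [zero_sub, inner_neg_right] at h1
      rw [inner_sub_right, real_inner_comm u z, real_inner_comm x z]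
      linarith
  · rintro ⟨hx, h⟩ u
    have h1 : supportFun (polyhedron S) z ≤ ((⟪x, z⟫ : ℝ) : EReal) :=
      supportFun_le_coe_iff.mpr fun w hw => by
        have := h w hw
        rw [inner_sub_right, real_inner_comm w z, real_inner_comm x z] at this
        linarith
    calc supportFun (polyhedron S) z + ((⟪x, u - z⟫ : ℝ) : EReal)
        ≤ ((⟪x, z⟫ : ℝ) : EReal) + ((⟪x, u - z⟫ : ℝ) : EReal) := by gcongr
      _ = ((⟪x, u⟫ : ℝ) : EReal) := by
          rw [← EReal.coe_add, inner_sub_right, add_sub_cancel]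
      _ ≤ supportFun (polyhedron S) u := coe_inner_le_supportFun hx u

/-- The graph of the normal cone map of a polyhedron is the union, over the sets `I` of constraints,
of the products of the face of `I` with the cone generated by the vectors of `I`. -/
lemma normal_iff_exists_face [CompleteSpace E] {S : Finset (E × ℝ)} {x v : E} :
    (x ∈ polyhedron S ∧ ∀ u ∈ polyhedron S, ⟪v, u - x⟫ ≤ 0) ↔
      ∃ I ⊆ S, x ∈ polyFace S I ∧ v ∈ finCone Prod.fst I :=
  ⟨fun h => ⟨activeSet S x, activeSet_subset S x, mem_polyFace_activeSet h.1,
    mem_finCone_activeSet h.1 h.2⟩,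
  fun ⟨_, hI, hx, hv⟩ => ⟨hx.1, fun _ hu => inner_sub_nonpos_of_mem_finCone hI hx hv hu⟩⟩

lemma hasPiecewiseSubdiff_indicatorFun [CompleteSpace E] {S : Finset (E × ℝ)}
    (hP : (polyhedron S).Nonempty) :
    HasPiecewiseSubdiff (indicatorFun (polyhedron S)) S (polyFace S) (finCone Prod.fst) where
  mem_subdiff_iff _ _ := (mem_subdiff_indicatorFun_iff hP).trans normal_iff_exists_face
  isClosed_left := isClosed_polyFace S
  isClosed_right := isClosed_finCone _
  tangentFeasible := tangentFeasible_polyFace S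

lemma hasPiecewiseSubdiff_supportFun [CompleteSpace E] {S : Finset (E × ℝ)}
    (hP : (polyhedron S).Nonempty) :
    HasPiecewiseSubdiff (supportFun (polyhedron S)) S (finCone Prod.fst) (polyFace S) where
  mem_subdiff_iff _ _ := (mem_subdiff_supportFun_iff hP).trans <| normal_iff_exists_face.trans <|
    exists_congr fun _ => and_congr_right fun _ => and_comm
  isClosed_left := isClosed_finCone _
  isClosed_right := isClosed_polyFace S
  tangentFeasible := tangentFeasible_finCone _

variable [FiniteDimensional ℝ E] {F : Type*} [NormedAddCommGroup F] [InnerProductSpace ℝ F]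
  [FiniteDimensional ℝ F]

lemma hasLinearErrorBound_subdiff_indicatorFun {S : Finset (E × ℝ)}
    (hP : (polyhedron S).Nonempty) (B : E →ₗ[ℝ] F) {z x : E}
    (hx : x ∈ subdiff (indicatorFun (polyhedron S)) z) :
    HasLinearErrorBound (subdiff (indicatorFun (polyhedron S)) z) B x := by
  have : CompleteSpace E := FiniteDimensional.complete ℝ E
  have hz := ((mem_subdiff_indicatorFun_iff hP).mp hx).1
  have hEq : subdiff (indicatorFun (polyhedron S)) z = finCone Prod.fst (activeSet S z) := by
    ext v
    rw [mem_subdiff_indicatorFun_iff hP]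
    exact ⟨fun h => mem_finCone_activeSet h.1 h.2, fun h => ⟨hz, fun u hu =>
      inner_sub_nonpos_of_mem_finCone (activeSet_subset S z) (mem_polyFace_activeSet hz) h hu⟩⟩
  rw [hEq] at hx ⊢
  exact hasLinearErrorBound_finCone _ _ B hx

lemma hasLinearErrorBound_subdiff_supportFun {S : Finset (E × ℝ)}
    (hP : (polyhedron S).Nonempty) (B : E →ₗ[ℝ] F) {z x : E}
    (hx : x ∈ subdiff (supportFun (polyhedron S)) z) :
    HasLinearErrorBound (subdiff (supportFun (polyhedron S)) z) B x := by
  classical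
  have hx' := (mem_subdiff_supportFun_iff hP).mp hx
  -- the maximizers of `⟨·, z⟩` are cut out by the constraint `⟨x, z⟩ ≤ ⟨·, z⟩`
  have hEq : subdiff (supportFun (polyhedron S)) z =
      polyhedron (insert (-z, -⟪z, x⟫) S) := by
    ext v
    have h1 : v ∈ polyhedron (insert (-z, -⟪z, x⟫) S) ↔ ⟪z, x⟫ ≤ ⟪z, v⟫ ∧ v ∈ polyhedron S := by
      refine (Finset.forall_mem_insert _ _ _).trans (and_congr_left fun _ => ?_)
      simp
    rw [mem_subdiff_supportFun_iff hP, h1]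
    constructor
    · rintro ⟨hv, h⟩
      have := h x hx'.1
      rw [inner_sub_right] at this
      exact ⟨by linarith, hv⟩
    · rintro ⟨h, hv⟩
      refine ⟨hv, fun u hu => ?_⟩
      have := hx'.2 u hu
      rw [inner_sub_right] at this ⊢
      linarith
  rw [hEq] at hx ⊢
  exact hasLinearErrorBound_polyhedron _ B hx

end PiecewiseSubdiff

/-! ### The KKT operator in terms of subgradients -/

section Operator

variable {X Y : Type*}
  [NormedAddCommGroup X] [InnerProductSpace ℝ X] [FiniteDimensional ℝ X]
  [NormedAddCommGroup Y] [InnerProductSpace ℝ Y] [FiniteDimensional ℝ Y]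
  {hs : Y → EReal} {ps : X → EReal} {A : X →ₗ[ℝ] Y} {c : X}

lemma lagrangian_eq_coe (hhs : IsProper hs) (hps : IsProper ps) {y : Y} {z : X}
    (hy : y ∈ effDom hs) (hz : z ∈ effDom ps) (x : X) :
    lagrangian hs ps A c y z x =
      (((hs y).toReal + (ps z).toReal - ⟪x, LinearMap.adjoint A y + z - c⟫ : ℝ) : EReal) := by
  rw [lagrangian, EReal.coe_sub, EReal.coe_add, coe_toReal_of_mem_effDom hhs.1 hy,
    coe_toReal_of_mem_effDom hps.1 hz]

lemma lagrangian_eq_top (hhs : IsProper hs) (hps : IsProper ps) {y : Y} {z : X}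
    (h : ¬(y ∈ effDom hs ∧ z ∈ effDom ps)) (x : X) : lagrangian hs ps A c y z x = ⊤ := by
  have hsum : hs y + ps z = ⊤ := by
    rcases not_and_or.mp h with h | h
    · have : hs y = ⊤ := not_lt_top_iff.mp h
      rw [this, EReal.top_add_of_ne_bot (hps.1 z)]
    · have : ps z = ⊤ := not_lt_top_iff.mp h
      rw [this, EReal.add_top_of_ne_bot (hhs.1 y)]
  rw [lagrangian, hsum, EReal.top_sub_coe]

/-- Where `h^*` or `p^*` is infinite, the Lagrangian is `+∞` and has no subgradients in `(y, z)`, so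
both sides are false there. Elsewhere the Lagrangian is separable in `y` and `z` and affine in
`x`. -/
lemma mem_opTl_iff (hhs : IsProper hs) (hps : IsProper ps) {q w : Y × X × X} :
    w ∈ opTl hs ps A c q ↔ A q.2.2 + w.1 ∈ subdiff hs q.1 ∧ q.2.2 + w.2.1 ∈ subdiff ps q.2.1 ∧
      w.2.2 = LinearMap.adjoint A q.1 + q.2.1 - c := by
  obtain ⟨y, z, x⟩ := q
  obtain ⟨w₁, w₂, w₃⟩ := w
  simp only [opTl, saddleSubdiff, mem_ofPred_eq]
  constructor
  · rintro ⟨h1, h2⟩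
    have hdom : y ∈ effDom hs ∧ z ∈ effDom ps := by
      by_contra hcon
      obtain ⟨y₀, hy₀⟩ := hhs.2
      obtain ⟨z₀, hz₀⟩ := hps.2
      have := h1 y₀ z₀
      rw [lagrangian_eq_top hhs hps hcon, lagrangian_eq_coe hhs hps hy₀ hz₀, EReal.top_add_coe,
        top_le_iff] at this
      exact EReal.coe_ne_top _ this
    have hr : ∀ y' ∈ effDom hs, ∀ z' ∈ effDom ps,
        (hs y).toReal + (ps z).toReal - ⟪x, LinearMap.adjoint A y + z - c⟫ +
          (⟪w₁, y' - y⟫ + ⟪w₂, z' - z⟫) ≤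
        (hs y').toReal + (ps z').toReal - ⟪x, LinearMap.adjoint A y' + z' - c⟫ := by
      intro y' hy' z' hz'
      have := h1 y' z'
      rw [lagrangian_eq_coe hhs hps hdom.1 hdom.2, lagrangian_eq_coe hhs hps hy' hz'] at this
      exact_mod_cast this
    refine ⟨mem_subdiff_of_forall_toReal hhs.1 hdom.1 fun y' hy' => ?_,
      mem_subdiff_of_forall_toReal hps.1 hdom.2 fun z' hz' => ?_, ?_⟩
    · have := hr y' hy' z hdom.2
      simp only [sub_self, inner_zero_right, inner_sub_right, inner_add_right,
        LinearMap.adjoint_inner_right] at this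
      simp only [inner_sub_right, inner_add_left]
      linarith
    · have := hr y hdom.1 z' hz'
      simp only [sub_self, inner_zero_right, inner_sub_right, inner_add_right] at this
      simp only [inner_sub_right, inner_add_left]
      linarith
    · have h3 := h2 (x + (w₃ - (LinearMap.adjoint A y + z - c)))
      rw [lagrangian_eq_coe hhs hps hdom.1 hdom.2, lagrangian_eq_coe hhs hps hdom.1 hdom.2,
        ← EReal.coe_add, EReal.coe_le_coe_iff, add_sub_cancel_left] at h3
      generalize LinearMap.adjoint A y + z - c = r at h3 ⊢
      rw [inner_add_left, inner_neg_left] at h3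
      have h4 : ⟪w₃ - r, w₃ - r⟫ = ⟪w₃, w₃ - r⟫ - ⟪w₃ - r, r⟫ := by
        rw [inner_sub_left, real_inner_comm r]
      exact sub_eq_zero.mp (inner_self_eq_zero.mp (le_antisymm (by linarith)
        (real_inner_self_nonneg (x := w₃ - r))))
  · rintro ⟨h1, h2, rfl⟩
    have hy := mem_effDom_of_mem_subdiff hhs h1
    have hz := mem_effDom_of_mem_subdiff hps h2
    refine ⟨fun y' z' => ?_, fun x' => ?_⟩
    · by_cases hdom : y' ∈ effDom hs ∧ z' ∈ effDom ps
      · rw [lagrangian_eq_coe hhs hps hy hz, lagrangian_eq_coe hhs hps hdom.1 hdom.2,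
          ← EReal.coe_add, EReal.coe_le_coe_iff]
        have h3 := toReal_add_inner_le hhs h1 hdom.1
        have h4 := toReal_add_inner_le hps h2 hdom.2
        simp only [inner_sub_right, inner_add_left, inner_add_right,
          LinearMap.adjoint_inner_right] at h3 h4 ⊢
        linarith
      · rw [lagrangian_eq_top hhs hps hdom]
        exact le_top
    · rw [lagrangian_eq_coe hhs hps hy hz, lagrangian_eq_coe hhs hps hy hz,
        ← EReal.coe_add, EReal.coe_le_coe_iff]
      generalize LinearMap.adjoint A y + z - c = r
      rw [inner_neg_left, inner_sub_right, real_inner_comm x' r, real_inner_comm x r]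
      linarith

/-! ### Error bounds near a solution -/

variable {xb : X} {yb : Y} {zb : X}

/-- Near a KKT point the distance of `x` to the set of multipliers is controlled by the residual
and the distance of `y` to `yb`. -/
lemma exists_multiplier_bound (hhs : EssentiallySmooth hs) (hps : IsProper ps) {K : ℝ≥0}
    {U : Set Y} (hU : U ∈ 𝓝 yb) (hlip : LipschitzOnWith K (grad hs) U)
    (hsub : ∀ᶠ z in 𝓝 zb, subdiff ps z ⊆ subdiff ps zb)
    (heb : HasLinearErrorBound (subdiff ps zb) A xb) (hkkt : A xb ∈ subdiff hs yb) :
    ∃ κ : ℝ, 0 ≤ κ ∧ ∀ᶠ q : Y × X × X in 𝓝 (yb, zb, xb), ∀ w ∈ opTl hs ps A c q,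
      ∃ x' ∈ subdiff ps zb, A x' = A xb ∧ ‖q.2.2 - x'‖ ≤ κ * (‖q.1 - yb‖ + ‖w‖) := by
  obtain ⟨H, hH, hb⟩ := heb
  set N := ‖A.toContinuousLinearMap‖
  have hyb := mem_interior_of_mem_subdiff hhs hkkt
  have hgb := eq_grad_of_mem_subdiff hhs.proper hyb (hhs.differentiableAt _ hyb) hkkt
  refine ⟨1 + H * (K + 1 + N), by positivity, ?_⟩
  have hy : ∀ᶠ q : Y × X × X in 𝓝 (yb, zb, xb), q.1 ∈ U :=
    (continuous_fst.tendsto (yb, zb, xb)).eventually hU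
  have hz : ∀ᶠ q : Y × X × X in 𝓝 (yb, zb, xb), subdiff ps q.2.1 ⊆ subdiff ps zb :=
    ((continuous_fst.comp continuous_snd).tendsto (yb, zb, xb)).eventually hsub
  filter_upwards [hy, hz] with q hqU hqs w hw
  obtain ⟨h1, h2, -⟩ := (mem_opTl_iff hhs.proper hps).mp hw
  have hq := mem_interior_of_mem_subdiff hhs h1
  have hg := eq_grad_of_mem_subdiff hhs.proper hq (hhs.differentiableAt _ hq) h1
  obtain ⟨x', hx', hAx', hle⟩ := hb _ (hqs h2)
  refine ⟨x', hx', hAx', ?_⟩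
  have hw1 : ‖w.1‖ ≤ ‖w‖ := norm_fst_le w
  have hw2 : ‖w.2.1‖ ≤ ‖w‖ := (norm_fst_le w.2).trans (norm_snd_le w)
  have hAw : ‖A w.2.1‖ ≤ N * ‖w‖ :=
    (A.toContinuousLinearMap.le_opNorm w.2.1).trans (by gcongr)
  have hres : ‖A (q.2.2 + w.2.1) - A xb‖ ≤ K * ‖q.1 - yb‖ + ‖w‖ + N * ‖w‖ := by
    have hEq : A (q.2.2 + w.2.1) - A xb = (grad hs q.1 - grad hs yb) - w.1 + A w.2.1 := by
      rw [← hg, ← hgb, map_add]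
      abel
    rw [hEq]
    refine (norm_add_le _ _).trans (add_le_add ((norm_sub_le _ _).trans (add_le_add ?_ hw1)) hAw)
    exact hlip.norm_sub_le hqU (mem_of_mem_nhds hU)
  calc ‖q.2.2 - x'‖ = ‖(q.2.2 + w.2.1 - x') - w.2.1‖ := by congr 1; abel
    _ ≤ H * (K * ‖q.1 - yb‖ + ‖w‖ + N * ‖w‖) + ‖w‖ :=
        (norm_sub_le _ _).trans (add_le_add (hle.trans (by gcongr)) hw2)
    _ ≤ (1 + H * (K + 1 + N)) * (‖q.1 - yb‖ + ‖w‖) := by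
        have hN : 0 ≤ N := norm_nonneg _
        have e1 : 0 ≤ (1 + H * (1 + N)) * ‖q.1 - yb‖ := by positivity
        have e2 : 0 ≤ H * K * ‖w‖ := by positivity
        linarith

/-- Monotonicity of the subdifferentials bounds the curvature term `⟨∇h^*(y) - ∇h^*(yb), y - yb⟩`
by products of the residual with the distances to the solution. -/
lemma inner_grad_sub_le (hhs : EssentiallySmooth hs) (hps : IsProper ps)
    (hkkt : IsKKT hs ps A c xb yb zb) {q w : Y × X × X} (hw : w ∈ opTl hs ps A c q) {x' : X}
    (hx' : x' ∈ subdiff ps zb) (hAx' : A x' = A xb) :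
    ⟪grad hs q.1 - grad hs yb, q.1 - yb⟫ ≤
      ‖q.2.2 - x'‖ * ‖w‖ + ‖w‖ * ‖q.1 - yb‖ + ‖w‖ * ‖q.2.1 - zb‖ := by
  obtain ⟨h1, h2, h3⟩ := (mem_opTl_iff hhs.proper hps).mp hw
  have hq := mem_interior_of_mem_subdiff hhs h1
  have hyb := mem_interior_of_mem_subdiff hhs hkkt.1
  rw [← eq_grad_of_mem_subdiff hhs.proper hq (hhs.differentiableAt _ hq) h1,
    ← eq_grad_of_mem_subdiff hhs.proper hyb (hhs.differentiableAt _ hyb) hkkt.1, ← hAx']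
  have hmono := inner_sub_nonneg_of_mem_subdiff hps h2 hx'
  have hw3 : LinearMap.adjoint A (q.1 - yb) = w.2.2 - (q.2.1 - zb) := by
    have := hkkt.2.2
    rw [h3, map_sub, ← sub_zero (LinearMap.adjoint A q.1 + q.2.1 - c), ← this]
    abel
  have hEq : ⟪A q.2.2 + w.1 - A x', q.1 - yb⟫ =
      ⟪q.2.2 - x', w.2.2⟫ + ⟪w.1, q.1 - yb⟫ + ⟪w.2.1, q.2.1 - zb⟫ -
        ⟪q.2.2 + w.2.1 - x', q.2.1 - zb⟫ := by
    have e1 : A q.2.2 + w.1 - A x' = A (q.2.2 - x') + w.1 := by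
      rw [map_sub]
      abel
    have e2 : q.2.2 + w.2.1 - x' = (q.2.2 - x') + w.2.1 := by abel
    rw [e1, e2, inner_add_left, inner_add_left, ← LinearMap.adjoint_inner_right, hw3,
      inner_sub_right (q.2.2 - x') w.2.2]
    ring
  rw [hEq]
  have b1 := (real_inner_le_norm (q.2.2 - x') w.2.2).trans
    (mul_le_mul_of_nonneg_left ((norm_snd_le w.2).trans (norm_snd_le w)) (norm_nonneg _))
  have b2 := (real_inner_le_norm w.1 (q.1 - yb)).trans
    (mul_le_mul_of_nonneg_right (norm_fst_le w) (norm_nonneg _))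
  have b3 := (real_inner_le_norm w.2.1 (q.2.1 - zb)).trans
    (mul_le_mul_of_nonneg_right ((norm_fst_le w.2).trans (norm_snd_le w)) (norm_nonneg _))
  linarith

end Operator

section Regularity

variable {X Y : Type*}
  [NormedAddCommGroup X] [InnerProductSpace ℝ X] [FiniteDimensional ℝ X]
  [NormedAddCommGroup Y] [InnerProductSpace ℝ Y] [FiniteDimensional ℝ Y]
  {hs : Y → EReal} {ps : X → EReal} {A : X →ₗ[ℝ] Y} {c : X} {xb : X} {yb : Y} {zb : X}

/-- A locally Lipschitz map with a directional derivative at `y` in the direction `d` has the same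
limit of difference quotients along every sequence that approaches `y` in the direction `d`. -/
lemma tendsto_diffQuot_of_hasDirDeriv {E : Type*} [NormedAddCommGroup E] [InnerProductSpace ℝ E]
    {G : E → E} {K : ℝ≥0} {U : Set E} {y d v : E} (hU : U ∈ 𝓝 y) (hlip : LipschitzOnWith K G U)
    (hG : HasDirDeriv G y d v) {u : ℕ → E} {t : ℕ → ℝ} (ht : ∀ k, 0 < t k)
    (htlim : Tendsto t atTop (𝓝 0)) (hu : Tendsto u atTop (𝓝 y))
    (hd : Tendsto (fun k => (t k)⁻¹ • (u k - y)) atTop (𝓝 d)) :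
    Tendsto (fun k => (t k)⁻¹ • (G (u k) - G y)) atTop (𝓝 v) := by
  have h1 : Tendsto (fun k => (t k)⁻¹ • (G (y + t k • d) - G y)) atTop (𝓝 v) :=
    Tendsto.comp hG (tendsto_nhdsWithin_iff.mpr ⟨htlim, Eventually.of_forall ht⟩)
  have h2 : Tendsto (fun k => y + t k • d) atTop (𝓝 y) := by
    simpa using (tendsto_const_nhds (x := y)).add (htlim.smul_const d)
  have h3 : Tendsto (fun k => (t k)⁻¹ • (G (u k) - G y) - (t k)⁻¹ • (G (y + t k • d) - G y)) atTop
      (𝓝 0) := by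
    have h4 : Tendsto (fun k => K * ‖(t k)⁻¹ • (u k - y) - d‖) atTop (𝓝 0) := by
      simpa using ((hd.sub_const d).norm).const_mul (K : ℝ)
    refine squeeze_zero_norm' ?_ h4
    filter_upwards [hu.eventually hU, h2.eventually hU] with k hk1 hk2
    have e1 : (t k)⁻¹ • (u k - y) - d = (t k)⁻¹ • (u k - (y + t k • d)) := by
      rw [← sub_sub, smul_sub _ (u k - y), smul_smul, inv_mul_cancel₀ (ht k).ne', one_smul]
    rw [← smul_sub, sub_sub_sub_cancel_right, e1, norm_smul, norm_smul, mul_left_comm]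
    gcongr
    exact hlip.norm_sub_le hk1 hk2
  simpa using h3.add h1

/-- Normalized differences from the solution accumulate at a critical direction `d` if the
residuals are of smaller order, and then the curvature of `h^*` along `d` vanishes. This is what
the second order sufficient condition excludes. -/
lemma exists_primal_bound (hhs : EssentiallySmooth hs) (hps : IsProper ps) {K : ℝ≥0}
    {U : Set Y} (hU : U ∈ 𝓝 yb) (hlip : LipschitzOnWith K (grad hs) U)
    {S : Finset (X × ℝ)} {C D : Finset (X × ℝ) → Set X} (hpw : HasPiecewiseSubdiff ps S C D)
    (heb : HasLinearErrorBound (subdiff ps zb) A xb) (hkkt : IsKKT hs ps A c xb yb zb)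
    (hsosc : SecondOrderSufficient hs ps A yb zb) :
    ∃ κ : ℝ, 0 ≤ κ ∧ ∀ᶠ q : Y × X × X in 𝓝 (yb, zb, xb), ∀ w ∈ opTl hs ps A c q,
      ‖(q.1 - yb, q.2.1 - zb)‖ ≤ κ * ‖w‖ := by
  obtain ⟨κ, hκ, hmult⟩ := exists_multiplier_bound (c := c) hhs hps hU hlip
    (hpw.eventually_subdiff_subset zb) heb hkkt.1
  have hyb := mem_interior_of_mem_subdiff hhs hkkt.1
  have hgb := eq_grad_of_mem_subdiff hhs.proper hyb (hhs.differentiableAt _ hyb) hkkt.1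
  by_contra hcon
  push Not at hcon
  have hseq : ∀ k : ℕ, ∃ q w : Y × X × X, dist q (yb, zb, xb) < 1 / ((k : ℝ) + 1) ∧
      w ∈ opTl hs ps A c q ∧ ((k : ℝ) + 1) * ‖w‖ < ‖(q.1 - yb, q.2.1 - zb)‖ ∧
      ∃ x' ∈ subdiff ps zb, A x' = A xb ∧ ‖q.2.2 - x'‖ ≤ κ * (‖q.1 - yb‖ + ‖w‖) := by
    intro k
    have hball : ∀ᶠ q : Y × X × X in 𝓝 (yb, zb, xb), dist q (yb, zb, xb) < 1 / ((k : ℝ) + 1) :=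
      Metric.ball_mem_nhds _ (by positivity)
    obtain ⟨q, ⟨w, hw, hlt⟩, hq, hm⟩ :=
      ((hcon ((k : ℝ) + 1) (by positivity)).and_eventually (hball.and hmult)).exists
    exact ⟨q, w, hq, hw, hlt, hm w hw⟩
  choose q w hq hw hlt x' hx' hAx' hbd using hseq
  set τ : ℕ → ℝ := fun k => ‖((q k).1 - yb, (q k).2.1 - zb)‖ with hτ
  have hτ0 : ∀ k, 0 < τ k := fun k => lt_of_le_of_lt (by positivity) (hlt k)
  have hqlim : Tendsto q atTop (𝓝 (yb, zb, xb)) :=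
    tendsto_iff_dist_tendsto_zero.mpr <| squeeze_zero (fun _ => dist_nonneg) (fun k => (hq k).le)
      tendsto_one_div_add_atTop_nhds_zero_nat
  have hρ : Tendsto (fun k => ‖w k‖ / τ k) atTop (𝓝 0) := by
    refine squeeze_zero (fun k => div_nonneg (norm_nonneg _) (hτ0 k).le) (fun k => ?_)
      tendsto_one_div_add_atTop_nhds_zero_nat
    rw [div_le_div_iff₀ (hτ0 k) (by positivity), one_mul, mul_comm]
    exact (hlt k).le
  obtain ⟨d, hd1, φ, hφ, hdlim⟩ := (isCompact_sphere (0 : Y × X) 1).tendsto_subseq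
    (x := fun k => (τ k)⁻¹ • ((q k).1 - yb, (q k).2.1 - zb)) fun k => by
      rw [mem_sphere_zero_iff_norm, norm_smul, norm_inv, Real.norm_of_nonneg (hτ0 k).le]
      exact inv_mul_cancel₀ (hτ0 k).ne'
  replace hqlim := hqlim.comp hφ.tendsto_atTop
  replace hρ := hρ.comp hφ.tendsto_atTop
  have hylim : Tendsto (fun k => (q (φ k)).1) atTop (𝓝 yb) := (continuous_fst.tendsto _).comp hqlim
  have hzlim : Tendsto (fun k => (q (φ k)).2.1) atTop (𝓝 zb) :=
    ((continuous_fst.comp continuous_snd).tendsto _).comp hqlim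
  have hxlim : Tendsto (fun k => (q (φ k)).2.2) atTop (𝓝 xb) :=
    ((continuous_snd.comp continuous_snd).tendsto _).comp hqlim
  have hdy : Tendsto (fun k => (τ (φ k))⁻¹ • ((q (φ k)).1 - yb)) atTop (𝓝 d.1) :=
    (continuous_fst.tendsto _).comp hdlim
  have hdz : Tendsto (fun k => (τ (φ k))⁻¹ • ((q (φ k)).2.1 - zb)) atTop (𝓝 d.2) :=
    (continuous_snd.tendsto _).comp hdlim
  have hτlim : Tendsto (fun k => τ (φ k)) atTop (𝓝 0) := by
    have := ((hylim.sub_const yb).prodMk_nhds (hzlim.sub_const zb)).norm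
    simpa [hτ] using this
  have hwlim : Tendsto (fun k => ‖w (φ k)‖) atTop (𝓝 0) := by
    have := hρ.mul hτlim
    rw [mul_zero] at this
    refine this.congr fun k => ?_
    exact div_mul_cancel₀ _ (hτ0 _).ne'
  have hmem := fun k => (mem_opTl_iff hhs.proper hps).mp (hw (φ k))
  have hray := hpw.eventually_mem_subdiff_ray (fun k => (hmem k).2.1) hzlim
    (by simpa using hxlim.add (squeeze_zero_norm
      (fun k => (norm_fst_le (w (φ k)).2).trans (norm_snd_le _)) hwlim))
    (fun k => hτ0 (φ k)) hdz
  obtain ⟨hdir, htan⟩ := hasDirDerivE_of_eventually_mem_subdiff hps hray.1 hray.2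
  have hAd : LinearMap.adjoint A d.1 + d.2 = 0 := by
    have h1 : Tendsto (fun k => LinearMap.adjoint A ((τ (φ k))⁻¹ • ((q (φ k)).1 - yb)) +
        (τ (φ k))⁻¹ • ((q (φ k)).2.1 - zb)) atTop (𝓝 (LinearMap.adjoint A d.1 + d.2)) :=
      (((LinearMap.adjoint A).continuous_of_finiteDimensional.tendsto _).comp hdy).add hdz
    refine tendsto_nhds_unique h1 (squeeze_zero_norm (fun k => ?_) hρ)
    have h2 : LinearMap.adjoint A ((τ (φ k))⁻¹ • ((q (φ k)).1 - yb)) +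
        (τ (φ k))⁻¹ • ((q (φ k)).2.1 - zb) = (τ (φ k))⁻¹ • (w (φ k)).2.2 := by
      rw [map_smul, ← smul_add, (hmem k).2.2, map_sub,
        ← sub_zero (LinearMap.adjoint A (q (φ k)).1 + (q (φ k)).2.1 - c), ← hkkt.2.2]
      congr 1
      abel
    rw [h2, norm_smul, norm_inv, Real.norm_of_nonneg (hτ0 _).le, Function.comp_apply,
      div_eq_inv_mul]
    exact mul_le_mul_of_nonneg_left ((norm_snd_le _).trans (norm_snd_le _))
      (inv_nonneg.mpr (hτ0 _).le)
  have hcrit : d ∈ criticalCone hs ps A yb zb := by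
    refine ⟨hAd, ⟨_, hdir, ?_⟩, htan⟩
    rw [← hgb, ← LinearMap.adjoint_inner_right, ← inner_add_right, hAd, inner_zero_right]
  have hd0 : d ≠ 0 := fun h => by simp [h] at hd1
  obtain ⟨v, hv, hpos⟩ := hsosc d hcrit hd0
  have hglim := tendsto_diffQuot_of_hasDirDeriv hU hlip hv (fun k => hτ0 (φ k)) hτlim hylim hdy
  have hbound : Tendsto (fun k => κ * (1 + ‖w (φ k)‖ / τ (φ k)) * (‖w (φ k)‖ / τ (φ k)) +
      2 * (‖w (φ k)‖ / τ (φ k))) atTop (𝓝 (κ * (1 + 0) * 0 + 2 * 0)) :=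
    (((hρ.const_add 1).const_mul κ).mul hρ).add (hρ.const_mul 2)
  have hle : ⟪v, d.1⟫ ≤ κ * (1 + 0) * 0 + 2 * 0 := by
    refine le_of_tendsto_of_tendsto' (hglim.inner hdy) hbound fun k => ?_
    have ht := hτ0 (φ k)
    have h1 := inner_grad_sub_le hhs hps hkkt (hw (φ k)) (hx' (φ k)) (hAx' (φ k))
    have hy1 : ‖(q (φ k)).1 - yb‖ ≤ τ (φ k) :=
      norm_fst_le ((q (φ k)).1 - yb, (q (φ k)).2.1 - zb)
    have hz1 : ‖(q (φ k)).2.1 - zb‖ ≤ τ (φ k) :=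
      norm_snd_le ((q (φ k)).1 - yb, (q (φ k)).2.1 - zb)
    have hx1 := hbd (φ k)
    rw [real_inner_smul_left, inner_smul_right]
    calc (τ (φ k))⁻¹ * ((τ (φ k))⁻¹ * ⟪grad hs (q (φ k)).1 - grad hs yb, (q (φ k)).1 - yb⟫)
        ≤ (τ (φ k))⁻¹ * ((τ (φ k))⁻¹ * (κ * (τ (φ k) + ‖w (φ k)‖) * ‖w (φ k)‖ +
            ‖w (φ k)‖ * τ (φ k) + ‖w (φ k)‖ * τ (φ k))) := by
          gcongr
          refine h1.trans ?_
          gcongr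
          exact hx1.trans (by gcongr)
      _ = _ := by
          field_simp
          ring
  rw [real_inner_comm] at hle
  linarith

lemma metricSubregularAt_opTl (hhs : EssentiallySmooth hs)
    (hlip : LocallyLipschitzOn (interior (effDom hs)) (grad hs)) (hps : IsProper ps)
    {S : Finset (X × ℝ)} {C D : Finset (X × ℝ) → Set X} (hpw : HasPiecewiseSubdiff ps S C D)
    (heb : HasLinearErrorBound (subdiff ps zb) A xb) (hkkt : IsKKT hs ps A c xb yb zb)
    (hsosc : SecondOrderSufficient hs ps A yb zb) :
    MetricSubregularAt (opTl hs ps A c) (yb, zb, xb) 0 := by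
  have hyb := mem_interior_of_mem_subdiff hhs hkkt.1
  have hsol : ∀ x' ∈ subdiff ps zb, A x' = A xb →
      (0 : Y × X × X) ∈ opTl hs ps A c (yb, zb, x') := by
    intro x' hx' hA
    refine (mem_opTl_iff hhs.proper hps).mpr ⟨?_, ?_, hkkt.2.2.symm⟩
    · simpa [hA] using hkkt.1
    · simpa using hx'
  obtain ⟨K, U, hU, hlipU⟩ := hlip hyb
  rw [isOpen_interior.nhdsWithin_eq hyb] at hU
  obtain ⟨κ₁, hκ₁, h1⟩ := exists_multiplier_bound (c := c) hhs hps hU hlipU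
    (hpw.eventually_subdiff_subset zb) heb hkkt.1
  obtain ⟨κ₂, hκ₂, h2⟩ := exists_primal_bound hhs hps hU hlipU hpw heb hkkt hsosc
  refine ⟨hsol xb hkkt.2.1 rfl, ⟨1 + κ₂ + κ₁ * (κ₂ + 1), by positivity⟩, _, h1.and h2, univ,
    univ_mem, fun q hq => ?_⟩
  set κ : ℝ≥0 := ⟨1 + κ₂ + κ₁ * (κ₂ + 1), by positivity⟩ with hκ
  -- `κ` is positive, so that the right-hand side is infinite when the operator is empty at `q`
  have hκ0 : κ ≠ 0 := by
    rw [Ne, ← NNReal.coe_eq_zero]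
    change ¬ (1 + κ₂ + κ₁ * (κ₂ + 1) = 0)
    positivity
  rw [inter_univ, mul_comm,
    ← ENNReal.div_le_iff_le_mul (Or.inl (by simpa using hκ0)) (Or.inl (by simp))]
  refine Metric.le_infEDist.mpr fun w hw => ?_
  rw [ENNReal.div_le_iff_le_mul (Or.inl (by simpa using hκ0)) (Or.inl (by simp))]
  obtain ⟨x', hx', hA, hle⟩ := hq.1 w hw
  have hprim := hq.2 w hw
  have hdist : dist q (yb, zb, x') ≤ κ * ‖w‖ := by
    change _ ≤ (1 + κ₂ + κ₁ * (κ₂ + 1)) * ‖w‖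
    have hw0 := norm_nonneg w
    have hy : ‖q.1 - yb‖ ≤ κ₂ * ‖w‖ :=
      (norm_fst_le (q.1 - yb, q.2.1 - zb)).trans hprim
    have hz : ‖q.2.1 - zb‖ ≤ κ₂ * ‖w‖ :=
      (norm_snd_le (q.1 - yb, q.2.1 - zb)).trans hprim
    have hx : ‖q.2.2 - x'‖ ≤ κ₁ * (κ₂ + 1) * ‖w‖ :=
      calc ‖q.2.2 - x'‖ ≤ κ₁ * (κ₂ * ‖w‖ + ‖w‖) := hle.trans (by gcongr)
        _ = κ₁ * (κ₂ + 1) * ‖w‖ := by ring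
    have e1 : 0 ≤ κ₂ * ‖w‖ := by positivity
    have e2 : 0 ≤ κ₁ * (κ₂ + 1) * ‖w‖ := by positivity
    rw [Prod.dist_eq, Prod.dist_eq, dist_eq_norm, dist_eq_norm, dist_eq_norm]
    refine max_le ?_ (max_le ?_ ?_) <;> linarith
  calc Metric.infEDist q {u' | 0 ∈ opTl hs ps A c u'} ≤ edist q (yb, zb, x') :=
        Metric.infEDist_le_edist_of_mem (hsol x' hx' hA)
    _ ≤ ENNReal.ofReal (κ * ‖w‖) := by
        rw [edist_dist]
        exact ENNReal.ofReal_le_ofReal hdist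
    _ = edist 0 w * κ := by
        rw [mul_comm, ENNReal.ofReal_mul (norm_nonneg _), ENNReal.ofReal_coe_nnreal, edist_comm,
          edist_zero_right, ofReal_norm]

end Regularity
end ConvexComposite

theorem mainTheorem1
    {X Y : Type*}
    [NormedAddCommGroup X] [InnerProductSpace ℝ X] [FiniteDimensional ℝ X]
    [NormedAddCommGroup Y] [InnerProductSpace ℝ Y] [FiniteDimensional ℝ Y]
    (A : X →ₗ[ℝ] Y) (c : X) (h : Y → ℝ) (p : X → EReal)
    (hh : IsClosedProperConvex (fun y => (h y : EReal)))
    (hp : IsClosedProperConvex p)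
    (hass : BlanketAssumption (fenchelConj (fun y => (h y : EReal))) (fenchelConj p))
    (xbar : X) (ybar : Y) (zbar : X)
    (hkkt : IsKKT (fenchelConj (fun y => (h y : EReal))) (fenchelConj p) A c xbar ybar zbar)
    (hsosc : SecondOrderSufficient (fenchelConj (fun y => (h y : EReal))) (fenchelConj p) A
      ybar zbar) :
    MetricSubregularAt (opTl (fenchelConj (fun y => (h y : EReal))) (fenchelConj p) A c)
      (ybar, zbar, xbar) 0 := by
  have : CompleteSpace X := FiniteDimensional.complete ℝ X
  obtain ⟨P, hne, ⟨S, hS⟩, hps⟩ := hass.polyhedral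
  obtain rfl : P = polyhedron S := hS
  rcases hps with hps | hps <;> rw [hps] at hkkt hsosc ⊢
  · exact metricSubregularAt_opTl hass.essentiallySmooth hass.locallyLipschitz_grad
      (isProper_indicatorFun hne) (hasPiecewiseSubdiff_indicatorFun hne)
      (hasLinearErrorBound_subdiff_indicatorFun hne A hkkt.2.1) hkkt hsosc
  · exact metricSubregularAt_opTl hass.essentiallySmooth hass.locallyLipschitz_grad
      (isProper_supportFun hne) (hasPiecewiseSubdiff_supportFun hne)
      (hasLinearErrorBound_subdiff_supportFun hne A hkkt.2.1) hkkt hsosc
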